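/- **Setting.** Let $M$ be a matroid on $E=\{1,\dots,m\}$ with weights $w\in\mathbb Z^m$, costs $c\in\mathbb Z_{\ge 0}^m$ and capacity $C\in\mathbb Z_{\ge0}$, such that $w_i\le w_j$ whenever $i<j$ lie in the same component of $M$. Let $\mathcal U=\{X\subseteq E: c(X)\le C\}$ and, for $X\subseteq E$, let $\mathcal L(X)$ be the set of bases of $M$ contained in $E\setminus X$ and $F(X)=\min\{w(Y):Y\in\mathcal L(X)\}\in\mathbb Z\cup\{\infty\}$ ($\infty$ if $\mathcal L(X)=\emptyset$). A pair $(X,Y)$ is feasible if $X\in\mathcal U$, $Y\in\mathcal L(X)$ and $w(Y)=F(X)$. The matroid interdiction problem asks for a feasible pair attaining $\mathrm{OPT}=\max_{X\in\mathcal U}F(X)$. The leader can reduce the rank if $\operatorname{r}(E\setminus X)<\operatorname{r}(E)$ for some $X\in\mathcal U$. Let $\mathrm B^{\min}(X)$ be the lexicographically smallest basis in $\mathcal L(X)$ (undefined if $\mathcal L(X)=\emptyset$); $X$ is undominated if $\mathrm B^{\min}(X')\neq \mathrm B^{\min}(X)$ for every $X'\subsetneq X$. Write $X_{<i}=\{x\in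 X:x<i\}$. **Bounds.** Let $T$ be a set with functions $\phi$ from subsets of $E$ to $T$ and $\pi:E\times T\to T$ such that $\phi(X_{<i}\cup\{i\})=\pi(i,\phi(X_{<i}))$ whenever $i \in E$ and $X\cup\{i\}\in\mathcal U$. For $0\le p\le m$ put $\phi_p(X)=(\phi(X),X\cap\{1,\dots,p\})$, and let $\pi_p(i,(s,Z))=(\pi(i,s),Z')$ with $Z'=Z\cup\{i\}$ if $i\le p$ and $Z'=Z$ otherwise. Let $\delta_p(i,r,s)\in\mathbb Z\cup\{\infty\}$ be such that for all $i\in E$, $r\in\{0,\dots,C\}$ with $c_i\le r$, all $s$, and all $X\in\mathcal U$ with $c(X_{<i})=C-r$ and $\phi_p(X_{<i})=s$, we have $F(X_{<i}\cup\{i\})\le F(X_{<i})+\delta_p(i,r,s)$. Let $f_p(i,r,s)=0$ if $i>m$; $f_p(i,r,s)=f_p(i+1,r,s)$ if $i\le m$ and $c_i>r$; and otherwise $f_p(i,r,s)=\max\{f_p(i+1,r,s),\,f_p(i+1,r-c_i,\pi_p(i,s))+\delta_p(i,r,s)\}$. **Algorithm.** A data structure $d$ holds a set $d.X$ (initially $\emptyset$),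 a basis $d.Y$ (initially $\mathrm B^{\min}(\emptyset)$) and a current element $d.e$ (initially the first element of $d.Y$; $m+1$ stands for "none"). *Skip* moves $d.e$ to the next element of $d.Y$. *Interdict*, with $e=d.e$, searches for the first $f>e$, $f\notin d.X\cup d.Y$, for which $(d.Y\setminus\{e\})\cup\{f\}$ is independent; it fails if there is none, and otherwise adds $e$ to $d.X$, replaces $e$ by $f$ in $d.Y$, and moves $d.e$ to the next element of $d.Y$ after $e$. Both operations can be undone. The incumbent $(X^*,Y^*)$ is initialized by the following greedy heuristic: starting with $X=\emptyset$, $Y=\mathrm B^{\min}(\emptyset)$, repeatedly interdict an affordable element $e\in Y$ (that is, $c_e\le C-c(X)$) that maximizes the ratio $(w_{r_k}-w_e)/\sum_{j\le k}c_{r_j}$ over $1\le k\le q$ (a zero denominator is replaced by $1$), where $e=r_0,r_1,\dots,r_q$ is its chain of successive replacement elements, the chain stopping when no next replacement exists or when the cost of $X$ and the chain including that next element would exceed $C$; stop when there is no such $e$ with $q\ge1$. Then $\mathrm{BranchAndBound}(0)$ is run, where $\mathrm{BranchAndBound}(i)$ does the following: 1. if $w(d.Y)>w(Y^*)$, set $(X^*,Y^*)\gets(d.X,d.Y)$;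 2. return if $i=\operatorname{r}(E)$, or $d.e>m$, or $c_x>C-c(d.X)$ for all $x\in E$ with $x\ge d.e$; 3. if some $f_p$ has already been computed (in the background), take such a $p$ and return ("prune") if $f_p(d.e,\,C-c(d.X),\,\phi_p(d.X))+w(d.Y)\le w(Y^*)$; 4. if $c_{d.e}\le C-c(d.X)$: *Interdict* (if it fails, output an error and halt), call $\mathrm{BranchAndBound}(i)$, undo *Interdict*; 5. *Skip*, call $\mathrm{BranchAndBound}(i+1)$, undo *Skip*. When it finishes without error, $(X^*,Y^*)$ is output. **Theorem.** Regardless of which bounds $f_p$ (if any) are available at which calls, the algorithm terminates and correctly solves the matroid interdiction problem. The same holds for any feasible initial incumbent in place of the one found by the greedy heuristic. More precisely: * At each call, $d.Y=\mathrm B^{\min}(d.X)$, and both $(d.X,d.Y)$ and the (updated) incumbent are feasible; if the call branches (reaches step 4), then $d.e\in d.Y$; if it is pruned in step 3, then $F(X)\le w(Y^*)$ for the current incumbent and every $X\in\mathcal U$ with $X_{<d.e}=d.X$. * If the leader can reduce the rank, the algorithm outputs an error. * Otherwise it does not output an error; its output $(X^*,Y^*)$ is feasible with $w(Y^*)=\mathrm{OPT}$;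 and each undominated $X\in\mathcal U$ is enumerated (there is a call with $d.X=X$) or there is a pruned call with $X_{<d.e}=d.X$. -/

import Mathlib

/-- A matroid is connected if it is not a direct sum of two nonempty matroids. -/
def MatroidConnected (N : Matroid ℕ) : Prop :=
  ¬ ∃ (N₁ N₂ : Matroid ℕ) (h : Disjoint N₁.E N₂.E),
    N₁.E.Nonempty ∧ N₂.E.Nonempty ∧ N = N₁.disjointSum N₂ h

/-- `S` is (the ground set of) a component of `M`: a maximal connected submatroid. -/
def IsMatroidComponent (M : Matroid ℕ) (S : Set ℕ) : Prop :=
  Maximal (fun R : Set ℕ => R ⊆ M.E ∧ MatroidConnected (M.restrict R)) S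

/-- An instance of matroid interdiction: a matroid on the ground set `{1, …, m}`, integer weights,
nonnegative integer costs and a nonnegative integer capacity. -/
structure Interdiction where
  m : ℕ
  M : Matroid ℕ
  ground : M.E = Set.Icc 1 m
  w : ℕ → ℤ
  c : ℕ → ℕ
  C : ℕ

/-- The content of the dynamic data structure: the interdicted elements `X`, the current basis `Y`,
the current element `e` (equal to `m + 1` when there is none), and the stack of pairs
(interdicted element, its replacement), used to undo interdictions. -/
structure DynInterdict where
  X : Finset ℕ
  Y : Finset ℕ
  e : ℕ
  stack : List (ℕ × ℕ)

/-- How a call of the branch-and-bound procedure proceeds: it returns because nothing is left to be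
interdicted, it returns because of the bound test, or it branches. -/
inductive NodeAction where
  | leaf
  | pruned
  | branched

/-- The record of one call of the branch-and-bound procedure: its argument `i`, the values of
`d.X`, `d.Y`, `d.e`, the incumbent (after it was updated by the call), and how the call proceeds. -/
structure BBNode where
  i : ℕ
  X : Finset ℕ
  Y : Finset ℕ
  e : ℕ
  best : Finset ℕ × Finset ℕ
  action : NodeAction

/-- The global variables: the data structure `d`, the incumbent `(X*, Y*)`, and the list of
the calls that were made so far (this list is not part of the algorithm, it only records the run). -/
structure BBState where
  d : DynInterdict
  best : Finset ℕ × Finset ℕ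
  log : List BBNode

/-- Whether the algorithm finishes normally (with the incumbent as its output) or outputs an error. -/
inductive BBStatus where
  | ok
  | error

namespace Interdiction

variable (P : Interdiction)

/-- The ground set `{1, …, m}`. -/
def E : Finset ℕ := Finset.Icc 1 P.m

def cost (X : Finset ℕ) : ℕ := ∑ x ∈ X, P.c x

def weight (Y : Finset ℕ) : ℤ := ∑ y ∈ Y, P.w y

/-- In every component, the elements are sorted by non-decreasing weight. -/
def Ordered : Prop :=
  ∀ S : Set ℕ, IsMatroidComponent P.M S → ∀ i ∈ S, ∀ j ∈ S, i < j → P.w i ≤ P.w j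

/-- The leader's feasible sets. -/
def Upper (X : Finset ℕ) : Prop := X ⊆ P.E ∧ P.cost X ≤ P.C

/-- The follower's feasible sets: the bases of the matroid that avoid `X`. -/
def Lower (X Y : Finset ℕ) : Prop := Y ⊆ P.E \ X ∧ P.M.IsBase (Y : Set ℕ)

open Classical in
/-- The follower's optimal value, `∞` if there is no basis that avoids `X`. -/
noncomputable def F (X : Finset ℕ) : WithTop ℤ :=
  (P.E.powerset.filter (P.Lower X)).inf fun Y => (P.weight Y : WithTop ℤ)

/-- Bilevel feasibility of `(X, Y)`. -/
def IsFeasible (XY : Finset ℕ × Finset ℕ) : Prop :=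
  P.Upper XY.1 ∧ P.Lower XY.1 XY.2 ∧ ∀ Y, P.Lower XY.1 Y → P.weight XY.2 ≤ P.weight Y

/-- The leader can interdict a set whose removal reduces the rank. -/
def RankReducible : Prop :=
  ∃ X, P.Upper X ∧ P.M.eRk ((P.E \ X : Finset ℕ) : Set ℕ) < P.M.eRank

/-- `B` is the lexicographically smallest basis that avoids `X`: for any other such basis `B'`
(which has the same number of elements), the smallest element in which the two differ is in `B`. -/
def IsLexMinBase (X B : Finset ℕ) : Prop :=
  P.Lower X B ∧ ∀ B', P.Lower X B' → B' ≠ B →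
    ∃ a ∈ B, a ∉ B' ∧ ∀ x < a, (x ∈ B ↔ x ∈ B')

open Classical in
/-- The lexicographically smallest basis that avoids `X`, undefined if no basis avoids `X`. -/
noncomputable def Bmin (X : Finset ℕ) : Option (Finset ℕ) :=
  if h : ∃ B, P.IsLexMinBase X B then some h.choose else none

/-- No proper subset of `X` leads to the same lexicographically smallest basis. -/
def Undominated (X : Finset ℕ) : Prop := ∀ X', X' ⊂ X → P.Bmin X' ≠ P.Bmin X

/-! ### The dynamic data structure -/

/-- The smallest element of `Y` after `e`, and `m + 1` if there is none. -/
def next (Y : Finset ℕ) (e : ℕ) : ℕ := (Y.filter (e < ·)).min.untopD (P.m + 1)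

/-- The largest element of `Y` before `e` (and `0` if there is none). -/
def prev (Y : Finset ℕ) (e : ℕ) : ℕ := (Y.filter (· < e)).max.unbotD 0

open Classical in
/-- The elements after `e`, not interdicted, which can be added to `Y \ {e}`. -/
noncomputable def candidates (X Y : Finset ℕ) (e : ℕ) : Finset ℕ :=
  P.E.filter fun f => e < f ∧ f ∉ X ∧ f ∉ Y ∧ P.M.Indep ((insert f (Y.erase e) : Finset ℕ) : Set ℕ)

open Classical in
/-- The search for the replacement element of `e`: the first element after `e` that is accepted
by the independence oracle. -/
noncomputable def repl (X Y : Finset ℕ) (e : ℕ) : Option ℕ :=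
  if h : (P.candidates X Y e).Nonempty then some ((P.candidates X Y e).min' h) else none

theorem repl_spec {X Y : Finset ℕ} {e f : ℕ} (h : P.repl X Y e = some f) : e < f ∧ f ≤ P.m := by
  unfold repl at h
  split_ifs at h with hne
  have hmem := Finset.min'_mem _ hne
  rw [Option.some.inj h] at hmem
  simp only [candidates, E, Finset.mem_filter, Finset.mem_Icc] at hmem
  exact ⟨hmem.2.1, hmem.1.2⟩

noncomputable def init : DynInterdict :=
  let Y := (P.Bmin ∅).getD ∅
  { X := ∅, Y := Y, e := P.next Y 0, stack := [] }

def skip (d : DynInterdict) : DynInterdict := { d with e := P.next d.Y d.e }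

def unSkip (d : DynInterdict) : DynInterdict := { d with e := prev d.Y d.e }

/-- `none` stands for the return value `false`. -/
noncomputable def interdict (d : DynInterdict) : Option DynInterdict :=
  match P.repl d.X d.Y d.e with
  | none => none
  | some f =>
    let Y := insert f (d.Y.erase d.e)
    some { X := insert d.e d.X, Y := Y, e := P.next Y d.e, stack := (d.e, f) :: d.stack }

def unInterdict (d : DynInterdict) : DynInterdict :=
  match d.stack with
  | [] => d
  | (e, f) :: rest => { X := d.X.erase e, Y := (insert e d.Y).erase f, e := e, stack := rest }

/-! ### The greedy lower bound -/

/-- The replacement chain of `e` without its first element `r₀ = e`: it repeatedly interdicts the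
last replacement, as long as the next replacement exists and would itself fit in the capacity. -/
noncomputable def chainTail (X Y : Finset ℕ) (e : ℕ) : List ℕ :=
  match _hf : P.repl X Y e with
  | none => []
  | some f =>
    if P.cost (insert f (insert e X)) ≤ P.C then
      f :: chainTail (insert e X) (insert f (Y.erase e)) f
    else []
termination_by P.m - e
decreasing_by
  have := P.repl_spec _hf
  omega

/-- The largest efficiency `(w(rᵢ) - w(e)) / ∑_{j ≤ i} c(rⱼ)` along the replacement chain of `e`
(`-∞` if the chain consists of `e` alone; the denominator is only changed when it is zero). -/
noncomputable def efficiency (X Y : Finset ℕ) (e : ℕ) : WithBot ℚ :=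
  let t := P.chainTail X Y e
  (Finset.range t.length).sup fun k =>
    ((((P.w (t.getD k 0) - P.w e : ℤ) : ℚ) /
      ((max 1 (P.c e + ((t.take (k + 1)).map P.c).sum) : ℕ) : ℚ) : ℚ) : WithBot ℚ)

/-- The choice of the element to interdict next, from the affordable elements of `Y`. -/
noncomputable def select (X Y : Finset ℕ) : Option ℕ :=
  (((Y.filter fun e => P.c e ≤ P.C - P.cost X).sort (· ≤ ·)).foldl
    (fun (bf : WithBot ℚ × Option ℕ) e =>
      if bf.1 < P.efficiency X Y e then (P.efficiency X Y e, some e) else bf)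
    (⊥, none)).2

/-- The loop of the greedy heuristic. The first argument limits the number of iterations, and
the value is `none` if the loop has not finished within this limit. -/
noncomputable def greedyLoop : ℕ → Finset ℕ → Finset ℕ → Option (Finset ℕ × Finset ℕ)
  | 0, _, _ => none
  | n + 1, X, Y =>
    match P.select X Y with
    | none => some (X, Y)
    | some f =>
      match P.repl X Y f with
      | none => none
      | some g => greedyLoop n (insert f X) (insert g (Y.erase f))

/-- The greedy heuristic, with a limit on the number of iterations of its loop. -/
noncomputable def lowerBound (limit : ℕ) : Option (Finset ℕ × Finset ℕ) :=
  (P.Bmin ∅).bind fun Y => P.greedyLoop limit ∅ Y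

/-! ### The upper bound -/

section Bound

variable {S : Type*}

/-- The set `X_{<i}`. -/
def below (X : Finset ℕ) (i : ℕ) : Finset ℕ := X.filter (· < i)

/-- The transition `π` describes how the state `φ` changes when an element is interdicted. -/
def PSucc (φ : Finset ℕ → S) (π : ℕ → S → S) : Prop :=
  ∀ i ∈ P.E, ∀ X, P.Upper (insert i X) → φ (insert i (below X i)) = π i (φ (below X i))

/-- `δ i r s` bounds the increase of the follower's value when `i` is interdicted in state `s`
with remaining capacity `r`. -/
def PBound (φ : Finset ℕ → S) (δ : ℕ → ℕ → S → WithTop ℤ) : Prop :=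
  ∀ i ∈ P.E, ∀ r ≤ P.C, ∀ s, P.c i ≤ r → ∀ X, P.Upper X →
    P.cost (below X i) = P.C - r → φ (below X i) = s →
      P.F (insert i (below X i)) ≤ P.F (below X i) + δ i r s

/-- The dynamic program `f`. -/
def dp (π : ℕ → S → S) (δ : ℕ → ℕ → S → WithTop ℤ) (i r : ℕ) (s : S) : WithTop ℤ :=
  if P.m < i then 0
  else if r < P.c i then dp π δ (i + 1) r s
  else max (dp π δ (i + 1) r s) (dp π δ (i + 1) (r - P.c i) (π i s) + δ i r s)
termination_by P.m + 1 - i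

/-- The state, strengthened by the interdicted elements among `1, …, p`. -/
def phiP (φ : Finset ℕ → S) (p : ℕ) (X : Finset ℕ) : S × Finset ℕ := (φ X, X.filter (· ≤ p))

def piP (π : ℕ → S → S) (p : ℕ) (i : ℕ) (s : S × Finset ℕ) : S × Finset ℕ :=
  (π i s.1, if i ≤ p then insert i s.2 else s.2)

/-! ### The branch-and-bound algorithm -/

/-- The first line of a call: update the incumbent. -/
def updateBest (s : BBState) : BBState :=
  if P.weight s.best.2 < P.weight s.d.Y then { s with best := (s.d.X, s.d.Y) } else s

/-- No basis element is left, or no remaining element fits in the capacity. -/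
def BaseCase (i : ℕ) (d : DynInterdict) : Prop :=
  (i : ℕ∞) = P.M.eRank ∨ P.m < d.e ∨ ∀ x ∈ P.E, d.e ≤ x → P.C - P.cost d.X < P.c x

/-- The bound test, when `f_p` is the best bound that has been computed (`none`: no bound yet). -/
def BoundTest (φ : Finset ℕ → S) (π : ℕ → S → S)
    (δ : ℕ → ℕ → ℕ → S × Finset ℕ → WithTop ℤ) (avail : Option ℕ) (s : BBState) : Prop :=
  ∃ p, avail = some p ∧
    P.dp (piP π p) (δ p) s.d.e (P.C - P.cost s.d.X) (phiP φ p s.d.X) + (P.weight s.d.Y : WithTop ℤ)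
      ≤ (P.weight s.best.2 : WithTop ℤ)

/-- Record a call. -/
def record (i : ℕ) (a : NodeAction) (s : BBState) : BBState :=
  { s with log := s.log ++ [⟨i, s.d.X, s.d.Y, s.d.e, s.best, a⟩] }

/-- Sequential composition: continue with `k`, unless an error was output. -/
def andThen (r : Option (BBStatus × BBState)) (k : BBState → Option (BBStatus × BBState)) :
    Option (BBStatus × BBState) :=
  match r with
  | none => none
  | some (.error, s) => some (.error, s)
  | some (.ok, s) => k s

open Classical in
/-- The recursive branch-and-bound procedure, acting on the global variables. Here `avail k` tells
which bound `f_p` is the best one that the background thread has finished when the call number `k`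
(counted from `0`) makes its bound test. The argument of type `ℕ` before `i` limits the recursion
depth, and the value is `none` if the limit is exceeded. -/
noncomputable def branchAndBound (φ : Finset ℕ → S) (π : ℕ → S → S)
    (δ : ℕ → ℕ → ℕ → S × Finset ℕ → WithTop ℤ) (avail : ℕ → Option ℕ) :
    ℕ → (i : ℕ) → BBState → Option (BBStatus × BBState)
  | 0, _, _ => none
  | n + 1, i, s₀ =>
    let s := P.updateBest s₀
    if P.BaseCase i s.d then some (.ok, record i .leaf s)
    else if P.BoundTest φ π δ (avail s.log.length) s then some (.ok, record i .pruned s)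
    else
      let s₁ := record i .branched s
      andThen
        (if P.c s₁.d.e ≤ P.C - P.cost s₁.d.X then
          match P.interdict s₁.d with
          | none => some (.error, s₁)
          | some d' =>
            andThen (branchAndBound φ π δ avail n i { s₁ with d := d' })
              fun s₂ => some (.ok, { s₂ with d := unInterdict s₂.d })
        else some (.ok, s₁))
        fun s₃ =>
          andThen (branchAndBound φ π δ avail n (i + 1) { s₃ with d := P.skip s₃.d })
            fun s₄ => some (.ok, { s₄ with d := unSkip s₄.d })

/-- The branch-and-bound algorithm with the initial incumbent `start`. -/
noncomputable def solveFrom (φ : Finset ℕ → S) (π : ℕ → S → S)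
    (δ : ℕ → ℕ → ℕ → S × Finset ℕ → WithTop ℤ) (avail : ℕ → Option ℕ)
    (start : Finset ℕ × Finset ℕ) (limit : ℕ) : Option (BBStatus × BBState) :=
  P.branchAndBound φ π δ avail limit 0 ⟨P.init, start, []⟩

/-- The complete algorithm: the initial incumbent is found by the greedy heuristic. -/
noncomputable def solve (φ : Finset ℕ → S) (π : ℕ → S → S)
    (δ : ℕ → ℕ → ℕ → S × Finset ℕ → WithTop ℤ) (avail : ℕ → Option ℕ) (limit : ℕ) :
    Option (BBStatus × BBState) :=
  (P.lowerBound limit).bind fun start => P.solveFrom φ π δ avail start limit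

end Bound

/-- What has to hold at each call: `d.Y` is the lexicographically smallest basis that avoids `d.X`,
`(d.X, d.Y)` and the incumbent are feasible, an element on which the call branches is in that basis,
and if the call is pruned, then no feasible set in its subtree (the sets that agree
with `d.X` before `d.e`) is better than the incumbent. -/
def NodeCorrect (n : BBNode) : Prop :=
  P.Bmin n.X = some n.Y ∧ P.IsFeasible (n.X, n.Y) ∧ P.IsFeasible n.best ∧
  (n.action = .branched → n.e ∈ n.Y) ∧
  (n.action = .pruned →
    ∀ X, P.Upper X → below X n.e = n.X → P.F X ≤ (P.weight n.best.2 : WithTop ℤ))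

/-- The run terminates (from some point on, the limit on iterations and recursion depth does not
matter) and is correct. If the leader can reduce the rank, an error
is output. Otherwise the output is a feasible solution with the optimal value, and each
undominated set in `𝒰` is enumerated or lies in the subtree of a pruned call. -/
def RunCorrect (run : ℕ → Option (BBStatus × BBState)) : Prop :=
  ∃ status s, (∃ N, ∀ limit ≥ N, run limit = some (status, s)) ∧
    (∀ n ∈ s.log, P.NodeCorrect n) ∧
    (P.RankReducible → status = .error) ∧
    (¬ P.RankReducible → status = .ok ∧ P.IsFeasible s.best ∧
      IsGreatest (P.F '' {X | P.Upper X}) (P.weight s.best.2 : WithTop ℤ) ∧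
      ∀ X, P.Upper X → P.Undominated X →
        (∃ n ∈ s.log, n.X = X) ∨ ∃ n ∈ s.log, n.action = .pruned ∧ below X n.e = n.X)

end Interdiction

/-! ### Circuits and components -/

/-! Weights and order are linked through circuits: a circuit restricts to a connected matroid, so it
lies in one component, where the weights are sorted. Hence the lexicographically smallest basis
avoiding `X` also has minimum weight, and `F X` depends only on `Bmin X`. This basis is handled
through a local criterion, `IsGreedyBase`: every element outside it and outside `X` is spanned by
smaller basis elements. Swapping `e` for its first replacement preserves the criterion
(`IsGreedyBase.interdict`), and a failed search proves that no basis avoids `X ∪ {e}`.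

The search branches only on elements of the current basis. For undominated sets this loses nothing:
an `x ∈ X` outside the greedy basis for the smaller elements of `X` is spanned by smaller elements
outside `X`, so removing it from `X` keeps `Bmin` (`Bmin_erase`). Therefore an undominated set skips
everything strictly between two consecutive candidates for `d.e` (`Undominated.below_next`). Since
each set contains an undominated one with the same `Bmin`, undominated sets suffice to determine the
optimum.

Pruning is sound because the dynamic program maximizes over all continuations, including the one
dictated by any given `X` (`F_le_F_add_dp`). Induction on `m + 1 - d.e` (`callsCorrect`) then shows
that a call finishing normally restores the data structure and covers all undominated sets of its
subtree. An error comes only from a failed search, which exhibits a rank reduction; conversely, a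
normal finish bounds every `F X` by a finite weight, which excludes a rank reduction. -/

theorem Matroid.IsCircuit.matroidConnected_restrict {M : Matroid ℕ} {K : Set ℕ}
    (hK : M.IsCircuit K) : MatroidConnected (M.restrict K) := by
  rintro ⟨N₁, N₂, h, ⟨a, ha⟩, ⟨b, hb⟩, heq⟩
  have hE : K = N₁.E ∪ N₂.E := by
    have := congrArg Matroid.E heq
    simpa using this
  have hind : ∀ I, (M.Indep I ∧ I ⊆ K) ↔
      N₁.Indep (I ∩ N₁.E) ∧ N₂.Indep (I ∩ N₂.E) ∧ I ⊆ N₁.E ∪ N₂.E := by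
    intro I
    rw [← Matroid.restrict_indep_iff, heq, Matroid.disjointSum_indep_iff]
  have hne : ∀ x, x ∈ N₂.E → x ∉ N₁.E := fun x hx hx' => (Set.disjoint_left.1 h) hx' hx
  -- Each summand is a proper subset of the circuit, hence independent; independence in a direct sum
  -- is tested summandwise, so `K` itself would be independent.
  have h1 : M.Indep N₁.E := by
    refine hK.ssubset_indep ⟨hE ▸ Set.subset_union_left, fun hs => hne b hb (hs ?_)⟩
    rw [hE]; exact Or.inr hb
  have h2 : M.Indep N₂.E := by
    refine hK.ssubset_indep ⟨hE ▸ Set.subset_union_right, fun hs => hne a (hs ?_) ha⟩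
    rw [hE]; exact Or.inl ha
  have h1' := ((hind N₁.E).1 ⟨h1, hE ▸ Set.subset_union_left⟩).1
  have h2' := ((hind N₂.E).1 ⟨h2, hE ▸ Set.subset_union_right⟩).2.1
  refine hK.not_indep ((hind K).2 ⟨?_, ?_, hE.le⟩).1
  · rw [hE, Set.union_inter_cancel_left]; simpa using h1'
  · rw [hE, Set.union_inter_cancel_right]; simpa using h2'

namespace Interdiction

variable {P : Interdiction}

theorem coe_E (P : Interdiction) : (P.E : Set ℕ) = P.M.E := by
  rw [P.ground]; simp [E]

theorem mem_E_iff {x : ℕ} : x ∈ P.E ↔ 1 ≤ x ∧ x ≤ P.m := by simp [E]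

theorem mem_ground {x : ℕ} (hx : x ∈ P.E) : x ∈ P.M.E := by
  rw [← P.coe_E]; exact hx

theorem finite_ground (P : Interdiction) : P.M.E.Finite := by
  rw [← P.coe_E]; exact P.E.finite_toSet

theorem rankFinite (P : Interdiction) : P.M.RankFinite :=
  have : P.M.Finite := ⟨P.finite_ground⟩
  inferInstance

/-- Since the ground set is finite, the connected set `K` extends to a maximal one, that is, to a
component. Later proofs access the ordering of the weights only in this form. -/
theorem Ordered.weight_le_of_isCircuit (hA : P.Ordered) {K : Set ℕ} (hK : P.M.IsCircuit K)
    {i j : ℕ} (hi : i ∈ K) (hj : j ∈ K) (hij : i < j) : P.w i ≤ P.w j := by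
  have hfin : {R : Set ℕ | R ⊆ P.M.E ∧ MatroidConnected (P.M.restrict R)}.Finite :=
    P.finite_ground.finite_subsets.subset fun R hR => hR.1
  obtain ⟨S, hKS, hS⟩ := hfin.exists_le_maximal
    (show K ∈ _ from ⟨hK.subset_ground, hK.matroidConnected_restrict⟩)
  exact hA S hS i (hKS hi) j (hKS hj) hij

/-! ### Greedy bases -/

theorem mem_below {X : Finset ℕ} {i x : ℕ} : x ∈ below X i ↔ x ∈ X ∧ x < i := by
  simp [below]

theorem below_subset (X : Finset ℕ) (i : ℕ) : below X i ⊆ X := Finset.filter_subset _ _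

/-- A basis that avoids `X` such that each element outside `X` and the basis is spanned by smaller
elements of the basis. -/
def IsGreedyBase (P : Interdiction) (X B : Finset ℕ) : Prop :=
  P.Lower X B ∧ ∀ f ∈ P.E, f ∉ X → f ∉ B → f ∈ P.M.closure (below B f : Set ℕ)

theorem Lower.mem_E {X B : Finset ℕ} (h : P.Lower X B) {x : ℕ} (hx : x ∈ B) : x ∈ P.E :=
  (Finset.mem_sdiff.1 (h.1 hx)).1

theorem Lower.notMem {X B : Finset ℕ} (h : P.Lower X B) {x : ℕ} (hx : x ∈ B) : x ∉ X :=
  (Finset.mem_sdiff.1 (h.1 hx)).2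

theorem IsGreedyBase.indep_below {X B : Finset ℕ} (h : P.IsGreedyBase X B) (i : ℕ) :
    P.M.Indep (below B i : Set ℕ) :=
  h.1.2.indep.subset (Finset.coe_subset.2 (below_subset _ _))

/-- Exchange in a basis, for finsets. -/
theorem isBase_insert_erase {B : Finset ℕ} (hB : P.M.IsBase (B : Set ℕ)) {e f : ℕ} (he : e ∈ B)
    (hf : f ∈ P.M.E) (hcl : f ∉ P.M.closure ((B.erase e : Finset ℕ) : Set ℕ)) :
    P.M.IsBase ((insert f (B.erase e) : Finset ℕ) : Set ℕ) := by
  have := hB.exchange_base_of_notMem_closure (e := e) (f := f) (by simpa using he)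
    (by simpa using hcl) hf
  simpa using this

/-- If `f ≤ e`, the elements of `B` below `f` survive the removal of `e` and still span `f`. Thus
searching for replacements only after `e` misses none. -/
theorem IsGreedyBase.lt_of_exchange {X B : Finset ℕ} (h : P.IsGreedyBase X B) {e f : ℕ}
    (hf : f ∈ P.E) (hfX : f ∉ X) (hfB : f ∉ B)
    (hind : P.M.Indep ((insert f (B.erase e) : Finset ℕ) : Set ℕ)) : e < f := by
  by_contra hlt
  have hfcl := h.2 f hf hfX hfB
  have hsub : (below B f : Set ℕ) ⊆ ((B.erase e : Finset ℕ) : Set ℕ) := by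
    intro x hx
    have := mem_below.1 (Finset.mem_coe.1 hx)
    simp only [Finset.coe_erase, Set.mem_sdiff, Finset.mem_coe, Set.mem_singleton_iff]
    exact ⟨this.1, by omega⟩
  have h2 := P.M.closure_subset_closure hsub hfcl
  have h3 := hind.notMem_closure_sdiff_of_mem (e := f) (by simp)
  apply h3
  convert h2 using 2
  ext x
  simp only [Finset.coe_insert, Set.mem_sdiff, Set.mem_insert_iff, Set.mem_singleton_iff,
    Finset.mem_coe, Finset.mem_erase]
  constructor
  · tauto
  · rintro ⟨h1, h2⟩
    exact ⟨Or.inr ⟨h1, h2⟩, fun hx => hfB (hx ▸ h2)⟩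

theorem below_congr {B B' : Finset ℕ} {a : ℕ} (h : ∀ x < a, (x ∈ B ↔ x ∈ B')) :
    below B a = below B' a := by
  ext x; simp only [mem_below]
  constructor
  · rintro ⟨h1, h2⟩; exact ⟨(h x h2).1 h1, h2⟩
  · rintro ⟨h1, h2⟩; exact ⟨(h x h2).2 h1, h2⟩

theorem notMem_closure_below {X B : Finset ℕ} (h : P.Lower X B) {a : ℕ} (ha : a ∈ B) :
    a ∉ P.M.closure (below B a : Set ℕ) := by
  intro hcl
  refine h.2.indep.notMem_closure_sdiff_of_mem (e := a) (by simpa using ha) ?_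
  refine P.M.closure_subset_closure ?_ hcl
  intro x hx
  have := mem_below.1 (Finset.mem_coe.1 hx)
  exact ⟨by simpa using this.1, by simpa using this.2.ne⟩

theorem IsGreedyBase.isLexMinBase {X B : Finset ℕ} (h : P.IsGreedyBase X B) :
    P.IsLexMinBase X B := by
  refine ⟨h.1, fun B' hB' hne => ?_⟩
  have hex : ∃ a, ¬ (a ∈ B ↔ a ∈ B') := by
    by_contra hcon
    push Not at hcon
    exact hne (Finset.ext fun x => (hcon x).symm)
  classical
  have hmin : ∀ x < Nat.find hex, (x ∈ B ↔ x ∈ B') := fun x hx => by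
    simpa using Nat.find_min hex hx
  have hspec := Nat.find_spec hex
  set a := Nat.find hex
  by_cases ha : a ∈ B
  · exact ⟨a, ha, by tauto, hmin⟩
  -- Otherwise the first difference `a` is spanned by the smaller elements of `B`, which are also
  -- those of `B'`, against the independence of `B'`.
  · have ha' : a ∈ B' := by tauto
    have h1 := h.2 a (hB'.mem_E ha') (hB'.notMem ha') ha
    rw [below_congr hmin] at h1
    exact absurd h1 (notMem_closure_below hB' ha')

theorem IsLexMinBase.unique {X B B' : Finset ℕ} (h : P.IsLexMinBase X B)
    (h' : P.IsLexMinBase X B') : B = B' := by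
  by_contra hne
  obtain ⟨a, haB, haB', hlt⟩ := h.2 B' h'.1 (Ne.symm hne)
  obtain ⟨b, hbB', hbB, hlt'⟩ := h'.2 B h.1 hne
  rcases lt_trichotomy a b with hab | hab | hab
  · exact haB' ((hlt' a hab).2 haB)
  · exact hbB (hab ▸ haB)
  · exact hbB ((hlt b hab).2 hbB')

theorem exists_isGreedyBase {X : Finset ℕ} (h : ∃ B, P.Lower X B) :
    ∃ B, P.IsGreedyBase X B := by
  classical
  have hfin : {B : Finset ℕ | P.Lower X B}.Finite :=
    (Finset.finite_toSet (P.E \ X).powerset).subset fun B hB => Finset.mem_coe.2 (Finset.mem_powerset.2 hB.1)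
  -- The sum of the labels serves as potential: exchanging `e` for `f` changes it by `f - e`, so at
  -- a minimum every other element of the fundamental circuit of `f` is smaller than `f`.
  obtain ⟨B, hB, hmin⟩ := Set.exists_min_image _ (fun B : Finset ℕ => ∑ x ∈ B, x) hfin h
  refine ⟨B, hB, fun f hf hfX hfB => ?_⟩
  have hfcl : f ∈ P.M.closure (B : Set ℕ) := by
    rw [hB.2.closure_eq]; exact mem_ground hf
  have hfB' : f ∉ (B : Set ℕ) := by simpa using hfB
  have hK := hB.2.indep.fundCircuit_isCircuit hfcl hfB'
  have hmem := hK.mem_closure_sdiff_singleton_of_mem (P.M.mem_fundCircuit f B)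
  refine P.M.closure_subset_closure ?_ hmem
  rintro e ⟨he, hef⟩
  have hef : e ≠ f := by simpa using hef
  have heB : e ∈ B := by
    have := P.M.fundCircuit_subset_insert f B he
    simpa [hef] using this
  have hind := (hB.2.indep.mem_fundCircuit_iff hfcl hfB').1 he
  have hseteq : insert f (B : Set ℕ) \ {e} = ((insert f (B.erase e) : Finset ℕ) : Set ℕ) := by
    ext x
    simp only [Set.mem_sdiff, Set.mem_insert_iff, Set.mem_singleton_iff, Finset.mem_coe,
      Finset.mem_insert, Finset.mem_erase]
    constructor
    · tauto
    · rintro (rfl | h)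
      · exact ⟨Or.inl rfl, hef.symm⟩
      · tauto
  rw [hseteq] at hind
  have hbase : P.M.IsBase ((insert f (B.erase e) : Finset ℕ) : Set ℕ) := by
    have := hB.2.exchange_isBase_of_indep (e := e) (f := f) hfB' (by simpa using hind)
    simpa using this
  have hlow : P.Lower X (insert f (B.erase e)) := by
    refine ⟨?_, hbase⟩
    intro x hx
    rcases Finset.mem_insert.1 hx with rfl | hx
    · exact Finset.mem_sdiff.2 ⟨hf, hfX⟩
    · exact hB.1 (Finset.mem_of_mem_erase hx)
  have hle := hmin _ hlow
  have hfe : f ∉ B.erase e := fun h => hfB (Finset.mem_of_mem_erase h)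
  rw [Finset.sum_insert hfe, ← Finset.add_sum_erase B _ heB] at hle
  simp only [Finset.mem_coe, mem_below]
  exact ⟨heB, by omega⟩

theorem isLexMinBase_iff {X B : Finset ℕ} : P.IsLexMinBase X B ↔ P.IsGreedyBase X B := by
  refine ⟨fun h => ?_, IsGreedyBase.isLexMinBase⟩
  obtain ⟨B', hB'⟩ := exists_isGreedyBase ⟨B, h.1⟩
  rwa [h.unique hB'.isLexMinBase]

theorem Bmin_eq_some_iff {X B : Finset ℕ} : P.Bmin X = some B ↔ P.IsGreedyBase X B := by
  rw [← isLexMinBase_iff]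
  unfold Bmin
  split_ifs with h
  · rw [Option.some_inj]
    exact ⟨fun hB => hB ▸ h.choose_spec, fun hB => h.choose_spec.unique hB⟩
  · exact ⟨fun h' => by simp at h', fun h' => absurd ⟨B, h'⟩ h⟩

theorem Bmin_eq_none_iff {X : Finset ℕ} : P.Bmin X = none ↔ ¬ ∃ B, P.Lower X B := by
  rw [Option.eq_none_iff_forall_ne_some]
  simp only [ne_eq, Bmin_eq_some_iff]
  constructor
  · rintro h hex
    obtain ⟨B, hB⟩ := exists_isGreedyBase hex
    exact h B hB
  · rintro h B hB
    exact h ⟨B, hB.1⟩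

/-! ### Weights -/

/-- Some `f ∈ B' \ B` is exchanged for a smaller `e ∈ B` on a common circuit. This does not increase
the weight and brings `B'` closer to `B`, whence the induction on `(B' \ B).card`. -/
theorem IsGreedyBase.weight_le (hA : P.Ordered) {X B : Finset ℕ} (h : P.IsGreedyBase X B) :
    ∀ n : ℕ, ∀ B', P.Lower X B' → (B' \ B).card = n → P.weight B ≤ P.weight B' := by
  intro n
  induction n with
  | zero =>
    intro B' hB' hcard
    have hsub : B' ⊆ B := by
      rw [Finset.card_eq_zero, Finset.sdiff_eq_empty_iff_subset] at hcard
      exact hcard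
    have : (B' : Set ℕ) = B := hB'.2.eq_of_subset_isBase h.1.2 (by exact_mod_cast hsub)
    rw [Finset.coe_injective this]
  | succ n ih =>
    intro B' hB' hcard
    obtain ⟨f, hf⟩ : (B' \ B).Nonempty := Finset.card_pos.1 (by omega)
    obtain ⟨hfB', hfB⟩ := Finset.mem_sdiff.1 hf
    have hfcl := h.2 f (hB'.mem_E hfB') (hB'.notMem hfB') hfB
    have hfb : f ∉ (below B f : Set ℕ) := fun hx => hfB (below_subset _ _ hx)
    have hK := (h.indep_below f).fundCircuit_isCircuit hfcl hfb
    have hfK := P.M.mem_fundCircuit f (below B f)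
    set K := P.M.fundCircuit f (below B f)
    have hmem := hK.mem_closure_sdiff_singleton_of_mem hfK
    have hnot := hB'.2.indep.notMem_closure_sdiff_of_mem (e := f) (by simpa using hfB')
    -- `K \ {f}` spans `f` but `B' \ {f}` does not, so some element of `K \ {f}` escapes the closure
    -- of the latter.
    obtain ⟨e, heK, hecl⟩ : ∃ e ∈ K \ {f}, e ∉ P.M.closure ((B' : Set ℕ) \ {f}) := by
      by_contra hcon
      push Not at hcon
      exact hnot (P.M.closure_subset_closure_of_subset_closure hcon hmem)
    have hef : e ≠ f := by simpa using heK.2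
    have heb : e ∈ below B f := by
      have := P.M.fundCircuit_subset_insert f (below B f) heK.1
      simpa [hef] using this
    obtain ⟨heB, helt⟩ := mem_below.1 heb
    have heE := mem_ground (h.1.mem_E heB)
    have heB' : e ∉ B' := by
      intro he
      refine hecl (P.M.mem_closure_of_mem' ⟨by simpa using he, by simpa using hef⟩ heE)
    have hbase := isBase_insert_erase hB'.2 hfB' heE (by simpa using hecl)
    have hlow : P.Lower X (insert e (B'.erase f)) := by
      refine ⟨?_, hbase⟩
      intro x hx
      rcases Finset.mem_insert.1 hx with rfl | hx
      · exact h.1.1 heB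
      · exact hB'.1 (Finset.mem_of_mem_erase hx)
    have hset : (insert e (B'.erase f)) \ B = (B' \ B).erase f := by
      ext x
      simp only [Finset.mem_sdiff, Finset.mem_insert, Finset.mem_erase]
      constructor
      · rintro ⟨rfl | h1, h2⟩
        · exact absurd heB h2
        · tauto
      · tauto
    have hle := ih _ hlow (by rw [hset, Finset.card_erase_of_mem hf, hcard]; rfl)
    have hw := hA.weight_le_of_isCircuit hK heK.1 hfK helt
    refine hle.trans ?_
    unfold weight
    rw [Finset.sum_insert (fun hx => heB' (Finset.mem_of_mem_erase hx)),
      ← Finset.add_sum_erase B' _ hfB']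
    linarith

theorem IsGreedyBase.weight_le_of_lower (hA : P.Ordered) {X B B' : Finset ℕ}
    (h : P.IsGreedyBase X B) (hB' : P.Lower X B') : P.weight B ≤ P.weight B' :=
  h.weight_le hA _ B' hB' rfl

theorem F_eq_of_isFeasible {XY : Finset ℕ × Finset ℕ} (h : P.IsFeasible XY) :
    P.F XY.1 = (P.weight XY.2 : WithTop ℤ) := by
  classical
  unfold F
  apply le_antisymm
  · refine Finset.inf_le (f := fun Y => (P.weight Y : WithTop ℤ)) ?_
    simp only [Finset.mem_filter, Finset.mem_powerset]
    exact ⟨fun x hx => h.2.1.mem_E hx, h.2.1⟩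
  · refine Finset.le_inf fun Y hY => ?_
    exact WithTop.coe_le_coe.2 (h.2.2 Y (Finset.mem_filter.1 hY).2)

theorem IsGreedyBase.isFeasible (hA : P.Ordered) {X B : Finset ℕ} (h : P.IsGreedyBase X B)
    (hX : P.Upper X) : P.IsFeasible (X, B) :=
  ⟨hX, h.1, fun _ hY => h.weight_le_of_lower hA hY⟩

theorem F_eq_top {X : Finset ℕ} (h : ¬ ∃ B, P.Lower X B) : P.F X = ⊤ := by
  classical
  unfold F
  rw [Finset.filter_false_of_mem fun Y _ hY => h ⟨Y, hY⟩, Finset.inf_empty]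

theorem F_congr (hA : P.Ordered) {X X' : Finset ℕ} (hX : P.Upper X) (hX' : P.Upper X')
    (h : P.Bmin X = P.Bmin X') : P.F X = P.F X' := by
  rcases hB : P.Bmin X with _ | B
  · rw [F_eq_top (Bmin_eq_none_iff.1 hB), F_eq_top (Bmin_eq_none_iff.1 (h ▸ hB))]
  · rw [F_eq_of_isFeasible ((Bmin_eq_some_iff.1 hB).isFeasible hA hX),
      F_eq_of_isFeasible ((Bmin_eq_some_iff.1 (h ▸ hB)).isFeasible hA hX')]

theorem eRk_lt_iff {X : Finset ℕ} :
    P.M.eRk ((P.E \ X : Finset ℕ) : Set ℕ) < P.M.eRank ↔ ¬ ∃ B, P.Lower X B := by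
  have := P.rankFinite
  rw [← not_le, not_iff_not]
  have hsub : ((P.E \ X : Finset ℕ) : Set ℕ) ⊆ P.M.E := by
    rw [← P.coe_E]; exact_mod_cast Finset.sdiff_subset
  rw [← Matroid.spanning_iff_eRk_le hsub]
  constructor
  · intro h
    obtain ⟨B, hB, hBs⟩ := h.exists_isBase_subset
    have hfin : B.Finite := (P.E \ X).finite_toSet.subset hBs
    refine ⟨hfin.toFinset, ?_, by simpa using hB⟩
    intro x hx
    exact_mod_cast hBs (hfin.mem_toFinset.1 hx)
  · rintro ⟨B, hB, hBb⟩
    exact hBb.spanning.superset (by exact_mod_cast hB) hsub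

theorem rankReducible_iff : P.RankReducible ↔ ∃ X, P.Upper X ∧ ¬ ∃ B, P.Lower X B := by
  unfold RankReducible
  simp only [eRk_lt_iff]

end Interdiction

namespace Interdiction

variable {P : Interdiction}

/-! ### Interdicting one element -/

theorem repl_eq_some {X Y : Finset ℕ} {e f : ℕ} (h : P.repl X Y e = some f) :
    f ∈ P.candidates X Y e ∧ ∀ g ∈ P.candidates X Y e, f ≤ g := by
  unfold repl at h
  split_ifs at h with hne
  obtain rfl := Option.some.inj h
  exact ⟨Finset.min'_mem _ hne, fun g hg => Finset.min'_le _ g hg⟩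

theorem repl_eq_none {X Y : Finset ℕ} {e : ℕ} (h : P.repl X Y e = none) :
    ∀ g, g ∉ P.candidates X Y e := by
  unfold repl at h
  split_ifs at h with hne
  intro g hg
  exact hne ⟨g, hg⟩

theorem mem_candidates {X Y : Finset ℕ} {e f : ℕ} :
    f ∈ P.candidates X Y e ↔ f ∈ P.E ∧ e < f ∧ f ∉ X ∧ f ∉ Y ∧
      P.M.Indep ((insert f (Y.erase e) : Finset ℕ) : Set ℕ) := by
  simp [candidates]

theorem IsGreedyBase.mem_candidates {X Y : Finset ℕ} (h : P.IsGreedyBase X Y) {e f : ℕ}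
    (hf : f ∈ P.E) (hfX : f ∉ X) (hfY : f ∉ Y)
    (hind : P.M.Indep ((insert f (Y.erase e) : Finset ℕ) : Set ℕ)) : f ∈ P.candidates X Y e :=
  Interdiction.mem_candidates.2 ⟨hf, h.lt_of_exchange hf hfX hfY hind, hfX, hfY, hind⟩

/-- This keeps the stored basis equal to `Bmin` without recomputation. Only an element `g > e`
outside the closure of `Y \ {e}` needs the new element `f`; such a `g` is a candidate itself, so `f`
precedes it. -/
theorem IsGreedyBase.interdict {X Y : Finset ℕ} (h : P.IsGreedyBase X Y) {e f : ℕ} (he : e ∈ Y)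
    (hf : P.repl X Y e = some f) : P.IsGreedyBase (insert e X) (insert f (Y.erase e)) := by
  obtain ⟨hfc, hmin⟩ := repl_eq_some hf
  obtain ⟨hfE, hef, hfX, hfY, hind⟩ := Interdiction.mem_candidates.1 hfc
  have hIe : P.M.Indep ((Y.erase e : Finset ℕ) : Set ℕ) :=
    h.1.2.indep.subset (Finset.coe_subset.2 (Finset.erase_subset _ _))
  have hfcl : f ∉ P.M.closure ((Y.erase e : Finset ℕ) : Set ℕ) := by
    rw [Finset.coe_insert, hIe.insert_indep_iff_of_notMem (by simp [hfY])] at hind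
    exact hind.2
  refine ⟨⟨?_, isBase_insert_erase h.1.2 he (mem_ground hfE) hfcl⟩, ?_⟩
  · intro x hx
    rcases Finset.mem_insert.1 hx with rfl | hx
    · exact Finset.mem_sdiff.2 ⟨hfE, fun h' => (Finset.mem_insert.1 h').elim hef.ne' hfX⟩
    · obtain ⟨hxe, hxY⟩ := Finset.mem_erase.1 hx
      exact Finset.mem_sdiff.2 ⟨h.1.mem_E hxY,
        fun h' => (Finset.mem_insert.1 h').elim hxe (h.1.notMem hxY)⟩
  intro g hg hgX hgY'
  rw [Finset.mem_insert, not_or] at hgX hgY'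
  obtain ⟨hge, hgX⟩ := hgX
  obtain ⟨hgf, hgY⟩ := hgY'
  have hgY : g ∉ Y := fun h' => hgY (Finset.mem_erase.2 ⟨hge, h'⟩)
  have hgcl := h.2 g hg hgX hgY
  rcases lt_or_gt_of_ne hge with hlt | hlt
  · refine P.M.closure_subset_closure ?_ hgcl
    intro x hx
    obtain ⟨hx1, hx2⟩ := mem_below.1 (Finset.mem_coe.1 hx)
    exact Finset.mem_coe.2 (mem_below.2
      ⟨Finset.mem_insert_of_mem (Finset.mem_erase.2 ⟨by omega, hx1⟩), hx2⟩)
  have hinter : (below Y g : Set ℕ) ∩ ((Y.erase e : Finset ℕ) : Set ℕ)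
      = (((below Y g).erase e : Finset ℕ) : Set ℕ) := by
    ext x
    simp only [Set.mem_inter_iff, Finset.mem_coe, mem_below, Finset.mem_erase]
    tauto
  -- For subsets of one independent set, closure commutes with intersection.
  have hcap : P.M.closure (below Y g : Set ℕ) ∩ P.M.closure ((Y.erase e : Finset ℕ) : Set ℕ)
      = P.M.closure (((below Y g).erase e : Finset ℕ) : Set ℕ) := by
    rw [← hinter, Matroid.Indep.closure_inter_eq_inter_closure]
    refine h.1.2.indep.subset (Set.union_subset ?_ ?_)
    · exact_mod_cast below_subset Y g
    · exact_mod_cast Finset.erase_subset e Y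
  by_cases hgc : g ∈ P.M.closure ((Y.erase e : Finset ℕ) : Set ℕ)
  · have hg' : g ∈ P.M.closure (((below Y g).erase e : Finset ℕ) : Set ℕ) := hcap ▸ ⟨hgcl, hgc⟩
    refine P.M.closure_subset_closure ?_ hg'
    intro x hx
    obtain ⟨hx0, hx⟩ := Finset.mem_erase.1 (Finset.mem_coe.1 hx)
    obtain ⟨hx1, hx2⟩ := mem_below.1 hx
    exact Finset.mem_coe.2 (mem_below.2
      ⟨Finset.mem_insert_of_mem (Finset.mem_erase.2 ⟨hx0, hx1⟩), hx2⟩)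
  have hfg : f < g := by
    refine lt_of_le_of_ne (hmin g (h.mem_candidates hg hgX hgY ?_)) (Ne.symm hgf)
    exact (isBase_insert_erase h.1.2 he (mem_ground hg) hgc).indep
  have heb : e ∈ below Y g := mem_below.2 ⟨he, hlt⟩
  have hins : (below Y g : Set ℕ) = insert e (((below Y g).erase e : Finset ℕ) : Set ℕ) := by
    rw [← Finset.coe_insert, Finset.insert_erase heb]
  have hfb : f ∈ P.M.closure (below Y g : Set ℕ) := by
    refine P.M.closure_subset_closure ?_ (h.2 f hfE hfX hfY)
    intro x hx
    obtain ⟨hx1, hx2⟩ := mem_below.1 (Finset.mem_coe.1 hx)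
    exact Finset.mem_coe.2 (mem_below.2 ⟨hx1, by omega⟩)
  -- `f` is spanned by the elements of `Y` below `g`, but not without `e`; by the exchange property
  -- `f` can replace `e` in this span.
  have hex : e ∈ P.M.closure (insert f (((below Y g).erase e : Finset ℕ) : Set ℕ)) := by
    refine (Matroid.closure_exchange ⟨hins ▸ hfb, ?_⟩).1
    intro h'
    exact hfcl (hcap.symm ▸ h' : f ∈ P.M.closure (below Y g : Set ℕ) ∩ _).2
  have hsub : (insert f (((below Y g).erase e : Finset ℕ) : Set ℕ))
      ⊆ (below (insert f (Y.erase e)) g : Set ℕ) := by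
    intro x hx
    refine Finset.mem_coe.2 (mem_below.2 ?_)
    rcases hx with rfl | hx
    · exact ⟨Finset.mem_insert_self _ _, hfg⟩
    · obtain ⟨hx0, hx⟩ := Finset.mem_erase.1 (Finset.mem_coe.1 hx)
      obtain ⟨hx1, hx2⟩ := mem_below.1 hx
      exact ⟨Finset.mem_insert_of_mem (Finset.mem_erase.2 ⟨hx0, hx1⟩), hx2⟩
  refine P.M.closure_subset_closure hsub (P.M.closure_subset_closure_of_subset_closure ?_ hgcl)
  rw [hins]
  refine Set.insert_subset hex (Set.Subset.trans (Set.subset_insert f _) ?_)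
  refine P.M.subset_closure _ ?_
  rintro x (rfl | hx)
  · exact mem_ground hfE
  · exact mem_ground (h.1.mem_E (below_subset _ _ (Finset.mem_of_mem_erase (Finset.mem_coe.1 hx))))

/-- Basis exchange towards a basis avoiding `insert e X` would supply a replacement for `e`, and by
`lt_of_exchange` the search would have met it. This justifies the error output. -/
theorem IsGreedyBase.not_lower_of_repl_eq_none {X Y : Finset ℕ} (h : P.IsGreedyBase X Y) {e : ℕ}
    (he : e ∈ Y) (hnone : P.repl X Y e = none) : ¬ ∃ B, P.Lower (insert e X) B := by
  rintro ⟨B, hB⟩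
  have heB : e ∉ B := fun h' => hB.notMem h' (Finset.mem_insert_self _ _)
  obtain ⟨f, hf, hbase⟩ := h.1.2.exchange hB.2 (e := e) ⟨by simpa using he, by simpa using heB⟩
  have hfB : f ∈ B := by simpa using hf.1
  have hfY : f ∉ Y := by simpa using hf.2
  have hfX : f ∉ X := fun h' => hB.notMem hfB (Finset.mem_insert_of_mem h')
  refine repl_eq_none hnone f (h.mem_candidates (hB.mem_E hfB) hfX hfY ?_)
  have := hbase.indep
  simpa using this

/-! ### Dominance -/

theorem IsGreedyBase.closure_compl_subset {X B : Finset ℕ} (h : P.IsGreedyBase X B) (x : ℕ) :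
    P.M.closure (below (P.E \ X) x : Set ℕ) ⊆ P.M.closure (below B x : Set ℕ) := by
  refine P.M.closure_subset_closure_of_subset_closure ?_
  intro y hy
  obtain ⟨hy1, hyx⟩ := mem_below.1 (Finset.mem_coe.1 hy)
  obtain ⟨hyE, hyX⟩ := Finset.mem_sdiff.1 hy1
  by_cases hyB : y ∈ B
  · exact P.M.mem_closure_of_mem' (Finset.mem_coe.2 (mem_below.2 ⟨hyB, hyx⟩)) (mem_ground hyE)
  · refine P.M.closure_subset_closure ?_ (h.2 y hyE hyX hyB)
    intro z hz
    obtain ⟨hz1, hz2⟩ := mem_below.1 (Finset.mem_coe.1 hz)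
    exact Finset.mem_coe.2 (mem_below.2 ⟨hz1, by omega⟩)

theorem below_sdiff_erase {A X : Finset ℕ} {x : ℕ} :
    below (A \ X.erase x) x = below (A \ X) x := by
  refine below_congr fun y hy => ?_
  simp only [Finset.mem_sdiff, Finset.mem_erase, not_and]
  have : y ≠ x := hy.ne
  tauto

/-- The greedy basis would reject `x` even if it were available, since smaller available elements
already span it. -/
theorem Bmin_erase {X : Finset ℕ} {x : ℕ}
    (hcl : x ∈ P.M.closure (below (P.E \ X) x : Set ℕ)) :
    P.Bmin (X.erase x) = P.Bmin X := by
  apply Option.ext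
  intro B
  rw [Bmin_eq_some_iff, Bmin_eq_some_iff]
  constructor
  · intro h
    have hxB : x ∉ B := fun hxB =>
      notMem_closure_below h.1 hxB (h.closure_compl_subset x (by rwa [below_sdiff_erase]))
    refine ⟨⟨fun y hy => ?_, h.1.2⟩, fun f hf hfX hfB => ?_⟩
    · refine Finset.mem_sdiff.2 ⟨h.1.mem_E hy, fun hyX => h.1.notMem hy ?_⟩
      exact Finset.mem_erase.2 ⟨fun hyx => hxB (hyx ▸ hy), hyX⟩
    · exact h.2 f hf (fun h' => hfX (Finset.mem_of_mem_erase h')) hfB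
  · intro h
    refine ⟨⟨fun y hy => ?_, h.1.2⟩, fun f hf hfX hfB => ?_⟩
    · exact Finset.mem_sdiff.2 ⟨h.1.mem_E hy,
        fun hyX => h.1.notMem hy (Finset.mem_of_mem_erase hyX)⟩
    · by_cases hfx : f = x
      · exact hfx ▸ h.closure_compl_subset x hcl
      · exact h.2 f hf (fun h' => hfX (Finset.mem_erase.2 ⟨hfx, h'⟩)) hfB

/-- In an undominated set, each element is in the greedy basis for the preceding elements. -/
theorem Undominated.mem_of_isGreedyBase {X Y : Finset ℕ} (hX : P.Undominated X) {x : ℕ}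
    (hx : x ∈ X) (hxE : x ∈ P.E) (hY : P.IsGreedyBase (below X x) Y) : x ∈ Y := by
  by_contra hxY
  -- If `x ∉ Y`, smaller elements of `Y` span `x`. They avoid `below X x`, and being smaller than
  -- `x` they avoid all of `X`, so `x` would be redundant in `X`.
  refine hX (X.erase x) (Finset.erase_ssubset hx) (Bmin_erase ?_)
  refine P.M.closure_subset_closure ?_
    (hY.2 x hxE (fun h => lt_irrefl x (mem_below.1 h).2) hxY)
  intro y hy
  obtain ⟨hyY, hyx⟩ := mem_below.1 (Finset.mem_coe.1 hy)
  refine Finset.mem_coe.2 (mem_below.2 ⟨Finset.mem_sdiff.2 ⟨hY.1.mem_E hyY, fun hyX => ?_⟩, hyx⟩)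
  exact hY.1.notMem hyY (mem_below.2 ⟨hyX, hyx⟩)

theorem Upper.mono {X X' : Finset ℕ} (hX : P.Upper X) (h : X' ⊆ X) : P.Upper X' :=
  ⟨h.trans hX.1, (Finset.sum_le_sum_of_subset h).trans hX.2⟩

theorem exists_undominated (P : Interdiction) (X : Finset ℕ) :
    ∃ X' ⊆ X, P.Undominated X' ∧ P.Bmin X' = P.Bmin X := by
  induction X using Finset.strongInduction with
  | H X ih =>
    by_cases hX : P.Undominated X
    · exact ⟨X, subset_rfl, hX, rfl⟩
    · unfold Undominated at hX
      push Not at hX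
      obtain ⟨Z, hZ, hB⟩ := hX
      obtain ⟨X', hX', hu, hB'⟩ := ih Z hZ
      exact ⟨X', hX'.trans hZ.subset, hu, hB'.trans hB⟩

/-! ### The bound -/

theorem below_succ_of_notMem {X : Finset ℕ} {i : ℕ} (h : i ∉ X) :
    below X (i + 1) = below X i := by
  ext x
  simp only [mem_below]
  constructor
  · rintro ⟨h1, h2⟩
    have : x ≠ i := fun hx => h (hx ▸ h1)
    exact ⟨h1, by omega⟩
  · rintro ⟨h1, h2⟩; exact ⟨h1, by omega⟩

theorem below_succ_of_mem {X : Finset ℕ} {i : ℕ} (h : i ∈ X) :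
    below X (i + 1) = insert i (below X i) := by
  ext x
  simp only [mem_below, Finset.mem_insert]
  constructor
  · rintro ⟨h1, h2⟩
    by_cases hx : x = i
    · exact Or.inl hx
    · exact Or.inr ⟨h1, by omega⟩
  · rintro (rfl | ⟨h1, h2⟩)
    · exact ⟨h, by omega⟩
    · exact ⟨h1, by omega⟩

theorem notMem_below (X : Finset ℕ) (i : ℕ) : i ∉ below X i :=
  fun h => lt_irrefl i (mem_below.1 h).2

theorem cost_insert {X : Finset ℕ} {i : ℕ} (h : i ∉ X) :
    P.cost (insert i X) = P.c i + P.cost X :=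
  Finset.sum_insert h

theorem PSucc.phiP {S : Type*} {φ : Finset ℕ → S} {π : ℕ → S → S} (h : P.PSucc φ π) (p : ℕ) :
    P.PSucc (phiP φ p) (piP π p) := by
  intro i hi X hX
  refine Prod.ext (h i hi X hX) ?_
  simp only [Interdiction.phiP, piP, Finset.filter_insert]

/-- Backward induction on `i`, following in the recursion of `dp` the branch chosen by `X` itself.
The increments given by `PBound` telescope from `below X i` to `X`. -/
theorem F_le_F_add_dp {S : Type*} {φ : Finset ℕ → S} {π : ℕ → S → S}
    {δ : ℕ → ℕ → S → WithTop ℤ} (hs : P.PSucc φ π) (hb : P.PBound φ δ) {X : Finset ℕ}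
    (hX : P.Upper X) (n : ℕ) : ∀ i, 1 ≤ i → P.m + 1 - i = n →
      P.F X ≤ P.F (below X i) +
        P.dp π δ i (P.C - P.cost (below X i)) (φ (below X i)) := by
  induction n with
  | zero =>
    intro i hi hn
    have : below X i = X := by
      ext x
      rw [mem_below]
      refine ⟨fun h => h.1, fun h => ⟨h, ?_⟩⟩
      have := (mem_E_iff.1 (hX.1 h)).2
      omega
    rw [dp, if_pos (by omega), this, add_zero]
  | succ n ih =>
    intro i hi hn
    have hi' := ih (i + 1) (by omega) (by omega)
    rw [dp, if_neg (by omega)]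
    by_cases hiX : i ∈ X
    · have hiE : i ∈ P.E := hX.1 hiX
      have hup : P.Upper (insert i (below X i)) :=
        hX.mono (Finset.insert_subset hiX (below_subset X i))
      have hc := hup.2
      rw [cost_insert (notMem_below X i)] at hc
      rw [below_succ_of_mem hiX, cost_insert (notMem_below X i),
        hs i hiE X (by rwa [Finset.insert_eq_of_mem hiX])] at hi'
      rw [if_neg (by omega)]
      -- The truncated subtraction is harmless because `below X i` is affordable.
      have hb' := hb i hiE (P.C - P.cost (below X i)) (Nat.sub_le _ _) _ (by omega) X hX
        (by omega) rfl
      refine hi'.trans ?_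
      refine (add_le_add_left hb' _).trans ?_
      rw [add_assoc]
      refine add_le_add_right ?_ _
      refine le_trans ?_ (le_max_right _ _)
      rw [add_comm, Nat.sub_sub, Nat.add_comm (P.c i)]
    · rw [below_succ_of_notMem hiX] at hi'
      refine hi'.trans (add_le_add_right ?_ _)
      split_ifs
      · exact le_rfl
      · exact le_max_left _ _

end Interdiction

namespace Interdiction

variable {P : Interdiction}

/-! ### Moving through a basis -/

theorem next_le {Y : Finset ℕ} {e y : ℕ} (hy : y ∈ Y) (hey : e < y) : P.next Y e ≤ y := by
  have hmem : y ∈ Y.filter (e < ·) := Finset.mem_filter.2 ⟨hy, hey⟩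
  obtain ⟨a, ha⟩ := Finset.min_of_mem hmem
  simp only [next, ha, WithTop.untopD_coe]
  exact Finset.min_le_of_eq hmem ha

theorem next_mem_or (Y : Finset ℕ) (e : ℕ) :
    (P.next Y e ∈ Y ∧ e < P.next Y e) ∨ (P.next Y e = P.m + 1 ∧ ∀ y ∈ Y, ¬ e < y) := by
  rcases (Y.filter (e < ·)).eq_empty_or_nonempty with h | h
  · right
    refine ⟨by simp [next, h], fun y hy hey => ?_⟩
    have : y ∈ Y.filter (e < ·) := Finset.mem_filter.2 ⟨hy, hey⟩
    simp [h] at this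
  · left
    obtain ⟨a, ha⟩ := Finset.min_of_nonempty h
    have := Finset.mem_filter.1 (Finset.mem_of_min ha)
    simp only [next, ha, WithTop.untopD_coe]
    exact this

theorem lt_next {Y : Finset ℕ} {e : ℕ} (he : e ≤ P.m) : e < P.next Y e := by
  rcases P.next_mem_or Y e with h | h
  · exact h.2
  · omega

theorem next_mem_or_eq (Y : Finset ℕ) (e : ℕ) : P.next Y e ∈ Y ∨ P.next Y e = P.m + 1 :=
  (P.next_mem_or Y e).imp And.left And.left

theorem prev_next {Y : Finset ℕ} {e : ℕ} (he : e ∈ Y) (hem : e ≤ P.m) :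
    prev Y (P.next Y e) = e := by
  have hmem : e ∈ Y.filter (· < P.next Y e) := Finset.mem_filter.2 ⟨he, lt_next hem⟩
  have hmax : (Y.filter (· < P.next Y e)).max = WithBot.some e := by
    refine le_antisymm (Finset.max_le fun y hy => WithBot.coe_le_coe.2 ?_) (Finset.le_max hmem)
    obtain ⟨hyY, hy⟩ := Finset.mem_filter.1 hy
    by_contra hlt
    have := P.next_le hyY (not_le.1 hlt)
    omega
  simp only [prev, hmax, WithBot.unbotD_coe]

theorem below_next {Y : Finset ℕ} {e : ℕ} (hem : e ≤ P.m) :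
    below Y (P.next Y e) = below Y (e + 1) := by
  ext y
  simp only [mem_below]
  have := P.lt_next (Y := Y) hem
  refine and_congr_right fun hy => ⟨fun hlt => ?_, fun hlt => by omega⟩
  by_contra hcon
  have := P.next_le hy (e := e) (by omega)
  omega

/-- The first element of `X` after `e` must lie in the greedy basis `Y` for the part of `X` up to
`e`, so it cannot precede the next element of `Y`. This is why jumping along the basis misses no
undominated set. -/
theorem Undominated.below_next {X Y : Finset ℕ} {e : ℕ} (hX : P.Undominated X) (hXE : X ⊆ P.E)
    (hY : P.IsGreedyBase (below X (e + 1)) Y) (hem : e ≤ P.m) :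
    below X (P.next Y e) = below X (e + 1) := by
  have key : ∀ x ∈ X, e < x → ¬ x < P.next Y e := by
    intro x
    induction x using Nat.strong_induction_on with
    | _ x ih =>
      intro hx hex hlt
      have hb : below X x = below X (e + 1) := by
        ext z
        simp only [mem_below]
        refine and_congr_right fun hz => ⟨fun hzx => ?_, fun hze => by omega⟩
        by_contra hcon
        exact ih z hzx hz (by omega) (by omega)
      have := hX.mem_of_isGreedyBase hx (hXE hx) (hb ▸ hY)
      have := P.next_le this hex
      omega
  ext z
  simp only [mem_below]
  have := P.lt_next (Y := Y) hem
  refine and_congr_right fun hz => ⟨fun hlt => ?_, fun hlt => by omega⟩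
  by_contra hcon
  exact key z hz (by omega) hlt

/-! ### The invariant of the data structure -/

/-- The state of the data structure at a call with argument `i`. -/
structure IsNodeState (P : Interdiction) (i : ℕ) (d : DynInterdict) : Prop where
  upper : P.Upper d.X
  greedy : P.IsGreedyBase d.X d.Y
  elem : d.e ∈ d.Y ∨ d.e = P.m + 1
  lt : ∀ x ∈ d.X, x < d.e
  card : (below d.Y d.e).card = i

theorem IsNodeState.one_le {i : ℕ} {d : DynInterdict} (h : P.IsNodeState i d) : 1 ≤ d.e := by
  rcases h.elem with he | he
  · exact (mem_E_iff.1 (h.greedy.1.mem_E he)).1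
  · omega

theorem IsNodeState.mem {i : ℕ} {d : DynInterdict} (h : P.IsNodeState i d)
    (hb : ¬ P.BaseCase i d) : d.e ∈ d.Y := by
  rcases h.elem with he | he
  · exact he
  · exact absurd (Or.inr (Or.inl (by omega))) hb

/-- The subtree of a leaf is trivial, so recording `d.X` covers it completely. -/
theorem IsNodeState.eq_of_baseCase {i : ℕ} {d : DynInterdict} (h : P.IsNodeState i d)
    (hb : P.BaseCase i d) {X : Finset ℕ} (hX : P.Upper X) (hXd : below X d.e = d.X) : X = d.X := by
  rw [← hXd]
  refine (Finset.filter_true_of_mem fun x hx => ?_).symm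
  by_contra hlt
  have hxE := hX.1 hx
  have hxm := mem_E_iff.1 hxE
  have hm : ¬ P.m < d.e := by omega
  rcases hb with hb | hb | hb
  · rw [← h.greedy.1.2.encard_eq_eRank, Set.encard_coe_eq_coe_finsetCard, Nat.cast_inj,
      ← h.card] at hb
    have := Finset.eq_of_subset_of_card_le (below_subset d.Y d.e) hb.ge
    have he : d.e ∈ d.Y := h.elem.resolve_right (by omega)
    rw [← this] at he
    exact notMem_below _ _ he
  · exact hm hb
  · have h1 := hb x hxE (by omega)
    have hnot : x ∉ below X d.e := fun h' => hlt (mem_below.1 h').2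
    have h2 := (hX.mono (Finset.insert_subset hx (below_subset X d.e))).2
    rw [cost_insert hnot, hXd] at h2
    omega

theorem IsNodeState.skip {i : ℕ} {d : DynInterdict} (h : P.IsNodeState i d) (he : d.e ∈ d.Y) :
    P.IsNodeState (i + 1) (P.skip d) := by
  have hem := (mem_E_iff.1 (h.greedy.1.mem_E he)).2
  refine ⟨h.upper, h.greedy, P.next_mem_or_eq d.Y d.e, fun x hx => ?_, ?_⟩
  · exact (h.lt x hx).trans (lt_next hem)
  · change (below d.Y (P.next d.Y d.e)).card = i + 1
    rw [Interdiction.below_next hem, below_succ_of_mem he,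
      Finset.card_insert_of_notMem (notMem_below _ _), h.card]

theorem unSkip_skip {i : ℕ} {d : DynInterdict} (h : P.IsNodeState i d) (he : d.e ∈ d.Y) :
    unSkip (P.skip d) = d := by
  have hem := (mem_E_iff.1 (h.greedy.1.mem_E he)).2
  have := P.prev_next he hem
  cases d
  simp_all [unSkip, Interdiction.skip]

theorem interdict_eq_some {d d' : DynInterdict} (h : P.interdict d = some d') :
    ∃ f, P.repl d.X d.Y d.e = some f ∧
      d' = ⟨insert d.e d.X, insert f (d.Y.erase d.e), P.next (insert f (d.Y.erase d.e)) d.e,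
        (d.e, f) :: d.stack⟩ := by
  unfold interdict at h
  split at h
  · simp at h
  · next f hf => exact ⟨f, hf, (Option.some.inj h).symm⟩

theorem interdict_eq_none {d : DynInterdict} (h : P.interdict d = none) :
    P.repl d.X d.Y d.e = none := by
  unfold interdict at h
  split at h
  · assumption
  · simp at h

theorem IsNodeState.notMem {i : ℕ} {d : DynInterdict} (h : P.IsNodeState i d) : d.e ∉ d.X :=
  fun he => lt_irrefl _ (h.lt _ he)

theorem IsNodeState.upper_insert {i : ℕ} {d : DynInterdict} (h : P.IsNodeState i d)
    (he : d.e ∈ d.Y) (hc : P.c d.e ≤ P.C - P.cost d.X) : P.Upper (insert d.e d.X) := by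
  refine ⟨Finset.insert_subset (h.greedy.1.mem_E he) h.upper.1, ?_⟩
  have := h.upper.2
  rw [cost_insert h.notMem]
  omega

theorem IsNodeState.interdict {i : ℕ} {d d' : DynInterdict} (h : P.IsNodeState i d)
    (he : d.e ∈ d.Y) (hc : P.c d.e ≤ P.C - P.cost d.X) (hd : P.interdict d = some d') :
    P.IsNodeState i d' := by
  obtain ⟨f, hf, rfl⟩ := interdict_eq_some hd
  have hem := (mem_E_iff.1 (h.greedy.1.mem_E he)).2
  have hef := (P.repl_spec hf).1
  refine ⟨h.upper_insert he hc, h.greedy.interdict he hf, P.next_mem_or_eq _ _, fun x hx => ?_, ?_⟩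
  · rcases Finset.mem_insert.1 hx with rfl | hx
    · exact lt_next hem
    · exact (h.lt x hx).trans (lt_next hem)
  · change (below _ (P.next _ d.e)).card = i
    rw [Interdiction.below_next hem, ← h.card]
    congr 1
    -- The replacement comes after `e`, so the basis elements before `e`, and hence `i`, do not
    -- change.
    ext y
    simp only [mem_below, Finset.mem_insert, Finset.mem_erase]
    constructor
    · rintro ⟨rfl | ⟨h1, h2⟩, h3⟩
      · omega
      · exact ⟨h2, by omega⟩
    · rintro ⟨h1, h2⟩
      exact ⟨Or.inr ⟨by omega, h1⟩, by omega⟩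

theorem unInterdict_interdict {i : ℕ} {d d' : DynInterdict} (h : P.IsNodeState i d)
    (he : d.e ∈ d.Y) (hd : P.interdict d = some d') : unInterdict d' = d := by
  obtain ⟨f, hf, rfl⟩ := interdict_eq_some hd
  obtain ⟨-, hef, -, hfY, -⟩ := mem_candidates.1 (repl_eq_some hf).1
  have h1 : (insert d.e d.X).erase d.e = d.X := Finset.erase_insert h.notMem
  have h2 : (insert d.e (insert f (d.Y.erase d.e))).erase f = d.Y := by
    rw [Finset.insert_comm, Finset.insert_erase he, Finset.erase_insert hfY]
  simp only [unInterdict, h1, h2]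

/-! ### The state of the algorithm -/

/-- The incumbent is feasible, and the recorded calls are correct and not better than it. -/
structure IsGoodState (P : Interdiction) (s : BBState) : Prop where
  feasible : P.IsFeasible s.best
  log : ∀ n ∈ s.log, P.NodeCorrect n ∧ P.weight n.Y ≤ P.weight s.best.2 ∧
    P.weight n.best.2 ≤ P.weight s.best.2

/-- The set `X` is enumerated or lies in the subtree of a pruned call. -/
def Covered (log : List BBNode) (X : Finset ℕ) : Prop :=
  (∃ n ∈ log, n.X = X) ∨ ∃ n ∈ log, n.action = .pruned ∧ below X n.e = n.X

theorem Covered.mono {l l' : List BBNode} (h : l ⊆ l') {X : Finset ℕ} (hX : Covered l X) :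
    Covered l' X := by
  rcases hX with ⟨n, hn, hX⟩ | ⟨n, hn, hX⟩
  · exact Or.inl ⟨n, h hn, hX⟩
  · exact Or.inr ⟨n, h hn, hX⟩

/-- The effect of a part of a run that is responsible for the sets with the property `Q`. -/
structure RunSpec (P : Interdiction) (Q : Finset ℕ → Prop) (s : BBState) (st : BBStatus)
    (s' : BBState) : Prop where
  good : P.IsGoodState s'
  log : s.log ⊆ s'.log
  error : st = .error → P.RankReducible
  restored : st = .ok → s'.d = s.d
  covered : st = .ok → ∀ X, P.Upper X → P.Undominated X → Q X → Covered s'.log X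

theorem updateBest_d (s : BBState) : (P.updateBest s).d = s.d := by
  unfold updateBest; split_ifs <;> rfl

theorem updateBest_log (s : BBState) : (P.updateBest s).log = s.log := by
  unfold updateBest; split_ifs <;> rfl

theorem le_updateBest (s : BBState) : P.weight s.d.Y ≤ P.weight (P.updateBest s).best.2 := by
  unfold updateBest; split_ifs with h
  · exact le_rfl
  · exact not_lt.1 h

theorem best_le_updateBest (s : BBState) :
    P.weight s.best.2 ≤ P.weight (P.updateBest s).best.2 := by
  unfold updateBest; split_ifs with h
  · exact h.le
  · exact le_rfl

theorem IsGoodState.updateBest (hA : P.Ordered) {i : ℕ} {s : BBState} (h : P.IsGoodState s)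
    (hd : P.IsNodeState i s.d) : P.IsGoodState (P.updateBest s) := by
  refine ⟨?_, fun n hn => ?_⟩
  · unfold Interdiction.updateBest; split_ifs
    · exact hd.greedy.isFeasible hA hd.upper
    · exact h.feasible
  · rw [updateBest_log] at hn
    obtain ⟨h1, h2, h3⟩ := h.log n hn
    exact ⟨h1, h2.trans (best_le_updateBest s), h3.trans (best_le_updateBest s)⟩

theorem IsGoodState.record (hA : P.Ordered) {i : ℕ} {s : BBState} (h : P.IsGoodState s)
    (hd : P.IsNodeState i s.d) (hle : P.weight s.d.Y ≤ P.weight s.best.2) (a : NodeAction)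
    (hbr : a = .branched → s.d.e ∈ s.d.Y)
    (hpr : a = .pruned → ∀ X, P.Upper X → below X s.d.e = s.d.X →
      P.F X ≤ (P.weight s.best.2 : WithTop ℤ)) : P.IsGoodState (record i a s) := by
  refine ⟨h.feasible, fun n hn => ?_⟩
  rcases List.mem_append.1 hn with hn | hn
  · exact h.log n hn
  · obtain rfl := List.mem_singleton.1 hn
    exact ⟨⟨Bmin_eq_some_iff.2 hd.greedy, hd.greedy.isFeasible hA hd.upper, h.feasible, hbr, hpr⟩,
      hle, le_rfl⟩

theorem log_subset_record (i : ℕ) (a : NodeAction) (s : BBState) : s.log ⊆ (record i a s).log :=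
  List.subset_append_left _ _

theorem mem_record (i : ℕ) (a : NodeAction) (s : BBState) :
    (⟨i, s.d.X, s.d.Y, s.d.e, s.best, a⟩ : BBNode) ∈ (record i a s).log :=
  List.mem_append_right _ (List.mem_singleton.2 rfl)

theorem IsGoodState.update_d {s : BBState} (h : P.IsGoodState s) (d : DynInterdict) :
    P.IsGoodState { s with d := d } :=
  ⟨h.feasible, h.log⟩

/-! ### Correctness of a call -/

section Run

variable {S : Type*} {φ : Finset ℕ → S} {π : ℕ → S → S} {δ : ℕ → ℕ → ℕ → S × Finset ℕ → WithTop ℤ}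
  {avail : ℕ → Option ℕ}

theorem IsNodeState.F_le_of_boundTest (hA : P.Ordered) (hsucc : P.PSucc φ π)
    (hbound : ∀ p ≤ P.m, P.PBound (phiP φ p) (δ p)) {o : Option ℕ} (ho : ∀ p, o = some p → p ≤ P.m)
    {i : ℕ} {s : BBState} (hd : P.IsNodeState i s.d) (ht : P.BoundTest φ π δ o s)
    {X : Finset ℕ} (hX : P.Upper X) (hXd : below X s.d.e = s.d.X) :
    P.F X ≤ (P.weight s.best.2 : WithTop ℤ) := by
  obtain ⟨p, hp, hle⟩ := ht
  have h := F_le_F_add_dp (hsucc.phiP p) (hbound p (ho p hp)) hX _ s.d.e hd.one_le rfl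
  rw [hXd, F_eq_of_isFeasible (hd.greedy.isFeasible hA hd.upper), add_comm] at h
  exact h.trans hle

/-- The branch of a call in which its current element is interdicted. -/
noncomputable def interdictBranch (P : Interdiction) (φ : Finset ℕ → S) (π : ℕ → S → S)
    (δ : ℕ → ℕ → ℕ → S × Finset ℕ → WithTop ℤ) (avail : ℕ → Option ℕ) (n i : ℕ) (s : BBState) :
    Option (BBStatus × BBState) :=
  if P.c s.d.e ≤ P.C - P.cost s.d.X then
    match P.interdict s.d with
    | none => some (.error, s)
    | some d' =>
      andThen (P.branchAndBound φ π δ avail n i { s with d := d' })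
        fun s₂ => some (.ok, { s₂ with d := unInterdict s₂.d })
  else some (.ok, s)

theorem branchAndBound_leaf {n i : ℕ} {s : BBState} (h : P.BaseCase i s.d) :
    P.branchAndBound φ π δ avail (n + 1) i s = some (.ok, record i .leaf (P.updateBest s)) := by
  rw [branchAndBound]
  exact if_pos (by rwa [updateBest_d])

theorem branchAndBound_pruned {n i : ℕ} {s : BBState} (h : ¬ P.BaseCase i s.d)
    (ht : P.BoundTest φ π δ (avail (P.updateBest s).log.length) (P.updateBest s)) :
    P.branchAndBound φ π δ avail (n + 1) i s = some (.ok, record i .pruned (P.updateBest s)) := by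
  rw [branchAndBound]
  exact (if_neg (by rwa [updateBest_d])).trans (if_pos ht)

theorem branchAndBound_branched {n i : ℕ} {s : BBState} (h : ¬ P.BaseCase i s.d)
    (ht : ¬ P.BoundTest φ π δ (avail (P.updateBest s).log.length) (P.updateBest s)) :
    P.branchAndBound φ π δ avail (n + 1) i s =
      andThen (P.interdictBranch φ π δ avail n i (record i .branched (P.updateBest s))) fun s₃ =>
        andThen (P.branchAndBound φ π δ avail n (i + 1) { s₃ with d := P.skip s₃.d })
          fun s₄ => some (.ok, { s₄ with d := unSkip s₄.d }) := by
  rw [branchAndBound]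
  exact (if_neg (by rwa [updateBest_d])).trans (if_neg ht)

/-- Calls with `m + 1 - d.e < k` terminate and are correct. -/
def CallsCorrect (P : Interdiction) (φ : Finset ℕ → S) (π : ℕ → S → S)
    (δ : ℕ → ℕ → ℕ → S × Finset ℕ → WithTop ℤ) (avail : ℕ → Option ℕ) (k : ℕ) : Prop :=
  ∀ i s, P.m + 1 - s.d.e < k → P.IsNodeState i s.d → P.IsGoodState s →
    ∃ st s', (∀ n ≥ k, P.branchAndBound φ π δ avail n i s = some (st, s')) ∧
      P.RunSpec (fun X => below X s.d.e = s.d.X) s st s'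

theorem interdictBranch_spec {k : ℕ} (hk : P.CallsCorrect φ π δ avail k) {i : ℕ} {s : BBState}
    (hsk : P.m + 1 - s.d.e ≤ k) (hd : P.IsNodeState i s.d) (he : s.d.e ∈ s.d.Y)
    (hs : P.IsGoodState s) :
    ∃ st s', (∀ n ≥ k, P.interdictBranch φ π δ avail n i s = some (st, s')) ∧
      P.RunSpec (fun X => below X s.d.e = s.d.X ∧ s.d.e ∈ X) s st s' := by
  have hem := (mem_E_iff.1 (hd.greedy.1.mem_E he)).2
  by_cases hc : P.c s.d.e ≤ P.C - P.cost s.d.X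
  · rcases hint : P.interdict s.d with _ | d'
    · refine ⟨.error, s, fun n _ => ?_, hs, List.Subset.refl _, fun _ => ?_, ?_, ?_⟩
      · simp only [interdictBranch, if_pos hc, hint]
      -- The affordable set `insert d.e d.X` witnesses the rank reduction.
      · exact rankReducible_iff.2 ⟨_, hd.upper_insert he hc,
          hd.greedy.not_lower_of_repl_eq_none he (interdict_eq_none hint)⟩
      · exact nofun
      · exact nofun
    · have hd' := hd.interdict he hc hint
      have hlt : s.d.e < d'.e ∧ ∀ X, P.Upper X → P.Undominated X → below X s.d.e = s.d.X →
          s.d.e ∈ X → below X d'.e = d'.X := by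
        obtain ⟨f, hf, rfl⟩ := interdict_eq_some hint
        refine ⟨lt_next hem, fun X hX hu hb heX => ?_⟩
        have hb' : below X (s.d.e + 1) = insert s.d.e s.d.X := by rw [below_succ_of_mem heX, hb]
        exact (hu.below_next hX.1 (hb' ▸ hd'.greedy) hem).trans hb'
      have hd'e : d'.e ≤ P.m + 1 := by
        rcases hd'.elem with h | h
        · have := (mem_E_iff.1 (hd'.greedy.1.mem_E h)).2; omega
        · exact h.le
      obtain ⟨st, s₂, hrun, hspec⟩ := hk i { s with d := d' }
        (by change P.m + 1 - d'.e < k; omega) hd' (hs.update_d d')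
      cases st with
      | error =>
        refine ⟨.error, s₂, fun n hn => ?_, hspec.good, hspec.log, hspec.error, ?_, ?_⟩
        · simp only [interdictBranch, if_pos hc, hint, hrun n hn, andThen]
        · exact nofun
        · exact nofun
      | ok =>
        refine ⟨.ok, { s₂ with d := unInterdict s₂.d }, fun n hn => ?_, hspec.good.update_d _,
          hspec.log, nofun, fun _ => ?_, fun _ X hX hu hb => ?_⟩
        · simp only [interdictBranch, if_pos hc, hint, hrun n hn, andThen]
        · change unInterdict s₂.d = s.d
          rw [hspec.restored rfl]
          exact unInterdict_interdict hd he hint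
        · exact hspec.covered rfl X hX hu (hlt.2 X hX hu hb.1 hb.2)
  · refine ⟨.ok, s, fun n _ => ?_, hs, List.Subset.refl _, nofun, fun _ => rfl,
      fun _ X hX hu hb => ?_⟩
    · simp only [interdictBranch, if_neg hc]
    · have h2 := (hX.mono (Finset.insert_subset hb.2 (below_subset X s.d.e))).2
      rw [cost_insert (notMem_below _ _), hb.1] at h2
      omega

/-- Both recursive calls strictly increase `d.e`, although interdiction keeps `i`; hence the
induction on `m + 1 - d.e`, which also bounds the recursion depth. The subtree splits according to
whether `d.e ∈ X`. -/
theorem callsCorrect (hA : P.Ordered) (hsucc : P.PSucc φ π)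
    (hbound : ∀ p ≤ P.m, P.PBound (phiP φ p) (δ p))
    (havail : ∀ k p, avail k = some p → p ≤ P.m) (k : ℕ) : P.CallsCorrect φ π δ avail k := by
  induction k with
  | zero => exact fun i s h => absurd h (Nat.not_lt_zero _)
  | succ k ih =>
    intro i s hsk hd hs
    have hdU : P.IsNodeState i (P.updateBest s).d := by rwa [updateBest_d]
    have hsU := hs.updateBest hA hd
    have hle : P.weight (P.updateBest s).d.Y ≤ P.weight (P.updateBest s).best.2 := by
      rw [updateBest_d]; exact le_updateBest s
    have hlog : ∀ a, s.log ⊆ (record i a (P.updateBest s)).log := fun a => by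
      conv_lhs => rw [← P.updateBest_log s]
      exact log_subset_record _ _ _
    have hrd : ∀ a, (record i a (P.updateBest s)).d = s.d := fun a => P.updateBest_d s
    by_cases hb : P.BaseCase i s.d
    · refine ⟨.ok, _, fun n hn => ?_, hsU.record hA hdU hle .leaf nofun
        nofun, hlog _, nofun, fun _ => hrd _, fun _ X hX _ hXd => ?_⟩
      · obtain ⟨n, rfl⟩ := Nat.exists_eq_add_of_lt (Nat.lt_of_lt_of_le (Nat.succ_pos k) hn)
        rw [Nat.zero_add]; exact branchAndBound_leaf hb
      · refine Or.inl ⟨_, mem_record _ _ _, ?_⟩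
        change (P.updateBest s).d.X = X
        rw [updateBest_d]
        exact (hd.eq_of_baseCase hb hX hXd).symm
    by_cases ht : P.BoundTest φ π δ (avail (P.updateBest s).log.length) (P.updateBest s)
    · refine ⟨.ok, _, fun n hn => ?_, hsU.record hA hdU hle .pruned nofun
        (fun _ X hX hXd => hdU.F_le_of_boundTest hA hsucc hbound (havail _) ht hX hXd),
        hlog _, nofun, fun _ => hrd _, fun _ X hX _ hXd => ?_⟩
      · obtain ⟨n, rfl⟩ := Nat.exists_eq_add_of_lt (Nat.lt_of_lt_of_le (Nat.succ_pos k) hn)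
        rw [Nat.zero_add]; exact branchAndBound_pruned hb ht
      · refine Or.inr ⟨_, mem_record _ _ _, rfl, ?_⟩
        change below X (P.updateBest s).d.e = (P.updateBest s).d.X
        rwa [updateBest_d]
    have he := hd.mem hb
    have hem := (mem_E_iff.1 (hd.greedy.1.mem_E he)).2
    have hs₁ : P.IsGoodState (record i .branched (P.updateBest s)) :=
      hsU.record hA hdU hle .branched (fun _ => by rwa [updateBest_d]) nofun
    obtain ⟨st, s₃, hrun, hspec⟩ := interdictBranch_spec ih (i := i)
      (s := record i .branched (P.updateBest s)) (by rw [hrd]; omega) (by rwa [hrd])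
      (by rwa [hrd]) hs₁
    have hstep : ∀ n ≥ k + 1, ∃ n' ≥ k, n = n' + 1 := fun n hn => ⟨n - 1, by omega, by omega⟩
    cases st with
    | error =>
      refine ⟨.error, s₃, fun n hn => ?_, hspec.good, List.Subset.trans (hlog _) hspec.log, hspec.error,
        nofun, nofun⟩
      obtain ⟨n, hn', rfl⟩ := hstep n hn
      rw [branchAndBound_branched hb ht, hrun n hn', andThen]
    | ok =>
      -- Undoing the interdiction lets the second call start from the original position, though with
      -- a possibly better incumbent.
      have hd₃ : s₃.d = s.d := (hspec.restored rfl).trans (hrd _)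
      have hsk₃ : P.m + 1 - (P.skip s₃.d).e < k := by
        have := P.lt_next (Y := s.d.Y) hem
        rw [hd₃]
        change P.m + 1 - P.next s.d.Y s.d.e < k
        omega
      obtain ⟨st', s₄, hrun', hspec'⟩ := ih (i + 1) { s₃ with d := P.skip s₃.d } hsk₃
        (by rw [hd₃]; exact hd.skip he) (hspec.good.update_d _)
      have hlog₃ : s₃.log ⊆ s₄.log := hspec'.log
      cases st' with
      | error =>
        refine ⟨.error, s₄, fun n hn => ?_, hspec'.good,
          List.Subset.trans (List.Subset.trans (hlog _) hspec.log) hlog₃, hspec'.error,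
          nofun, nofun⟩
        obtain ⟨n, hn', rfl⟩ := hstep n hn
        rw [branchAndBound_branched hb ht, hrun n hn', andThen, hrun' n hn', andThen]
      | ok =>
        refine ⟨.ok, { s₄ with d := unSkip s₄.d }, fun n hn => ?_, hspec'.good.update_d _,
          List.Subset.trans (List.Subset.trans (hlog _) hspec.log) hlog₃, nofun, fun _ => ?_,
          fun _ X hX hu hXd => ?_⟩
        · obtain ⟨n, hn', rfl⟩ := hstep n hn
          rw [branchAndBound_branched hb ht, hrun n hn', andThen, hrun' n hn', andThen]
        · change unSkip s₄.d = s.d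
          rw [hspec'.restored rfl]
          change unSkip (P.skip s₃.d) = s.d
          rw [hd₃]
          exact unSkip_skip hd he
        · by_cases heX : s.d.e ∈ X
          · exact (hspec.covered rfl X hX hu (by rw [hrd]; exact ⟨hXd, heX⟩)).mono hlog₃
          · refine hspec'.covered rfl X hX hu ?_
            change below X (P.skip s₃.d).e = (P.skip s₃.d).X
            rw [hd₃]
            have hb' : below X (s.d.e + 1) = s.d.X := by rw [below_succ_of_notMem heX, hXd]
            exact (hu.below_next hX.1 (hb' ▸ hd.greedy) hem).trans hb'

end Run

end Interdiction

namespace Interdiction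

variable {P : Interdiction}

/-! ### Correctness of the algorithm -/

theorem exists_lower_empty (P : Interdiction) : ∃ B, P.Lower ∅ B := by
  obtain ⟨B, hB⟩ := P.M.exists_isBase
  have hfin : B.Finite := P.finite_ground.subset hB.subset_ground
  refine ⟨hfin.toFinset, fun x hx => ?_, by simpa using hB⟩
  have hx' := hB.subset_ground (hfin.mem_toFinset.1 hx)
  rw [← P.coe_E] at hx'
  simpa using hx'

theorem exists_Bmin_empty (P : Interdiction) :
    ∃ B, P.Bmin ∅ = some B ∧ P.IsGreedyBase ∅ B := by
  obtain ⟨B, hB⟩ := exists_isGreedyBase P.exists_lower_empty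
  exact ⟨B, Bmin_eq_some_iff.2 hB, hB⟩

theorem upper_empty (P : Interdiction) : P.Upper ∅ :=
  ⟨Finset.empty_subset _, by simp [cost]⟩

theorem isNodeState_init (P : Interdiction) : P.IsNodeState 0 P.init := by
  obtain ⟨B, hB, hG⟩ := P.exists_Bmin_empty
  have hY : P.init.Y = B := by simp [init, hB]
  have hbelow : below B 1 = ∅ := by
    refine Finset.eq_empty_of_forall_notMem fun y hy => ?_
    have h1 := mem_below.1 hy
    have := (mem_E_iff.1 (hG.1.mem_E h1.1)).1
    omega
  refine ⟨P.upper_empty, hY ▸ hG, P.next_mem_or_eq _ _, fun x hx => ?_, ?_⟩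
  · exact absurd hx (Finset.notMem_empty x)
  · change (below P.init.Y (P.next P.init.Y 0)).card = 0
    -- The label `0` acts as a virtual element before the ground set, so that the first basis
    -- element is its successor.
    rw [Interdiction.below_next (Nat.zero_le _), hY, Nat.zero_add, hbelow, Finset.card_empty]

theorem below_init {X : Finset ℕ} (hX : P.Upper X) (hu : P.Undominated X) :
    below X P.init.e = P.init.X := by
  have hb : below X (0 + 1) = ∅ := by
    refine Finset.eq_empty_of_forall_notMem fun y hy => ?_
    have h1 := mem_below.1 hy
    have := (mem_E_iff.1 (hX.1 h1.1)).1
    omega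
  exact (hu.below_next hX.1 (hb.symm ▸ P.isNodeState_init.greedy) (Nat.zero_le _)).trans hb

section Run

variable {S : Type*} {φ : Finset ℕ → S} {π : ℕ → S → S} {δ : ℕ → ℕ → ℕ → S × Finset ℕ → WithTop ℤ}
  {avail : ℕ → Option ℕ}

theorem IsGoodState.F_le_of_covered {s : BBState} (hs : P.IsGoodState s) {X : Finset ℕ}
    (hX : P.Upper X) (hc : Covered s.log X) : P.F X ≤ (P.weight s.best.2 : WithTop ℤ) := by
  rcases hc with ⟨n, hn, rfl⟩ | ⟨n, hn, hp, hb⟩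
  · obtain ⟨hcorr, hle, -⟩ := hs.log n hn
    rw [F_eq_of_isFeasible hcorr.2.1]
    exact WithTop.coe_le_coe.2 hle
  · obtain ⟨hcorr, -, hle⟩ := hs.log n hn
    exact (hcorr.2.2.2.2 hp X hX hb).trans (WithTop.coe_le_coe.2 hle)

theorem runCorrect_solveFrom (hA : P.Ordered) (hsucc : P.PSucc φ π)
    (hbound : ∀ p ≤ P.m, P.PBound (phiP φ p) (δ p))
    (havail : ∀ k p, avail k = some p → p ≤ P.m) {start : Finset ℕ × Finset ℕ}
    (hstart : P.IsFeasible start) : P.RunCorrect (P.solveFrom φ π δ avail start) := by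
  obtain ⟨st, s, hrun, hspec⟩ := callsCorrect hA hsucc hbound havail (P.m + 2) 0
    ⟨P.init, start, []⟩ (by omega) P.isNodeState_init ⟨hstart, fun n hn => by simp at hn⟩
  have hle : st = .ok → ∀ X, P.Upper X → P.F X ≤ (P.weight s.best.2 : WithTop ℤ) := by
    intro hok X hX
    -- Only undominated sets are covered by the search; any other set is replaced by an undominated
    -- subset with the same `Bmin`, hence the same value.
    obtain ⟨X', hX', hu, hB⟩ := P.exists_undominated X
    have hup := hX.mono hX'
    rw [← F_congr hA hup hX hB]
    exact hspec.good.F_le_of_covered hup (hspec.covered hok X' hup hu (below_init hup hu))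
  refine ⟨st, s, ⟨P.m + 2, hrun⟩, fun n hn => (hspec.good.log n hn).1, fun hred => ?_,
    fun hred => ?_⟩
  · cases st with
    | error => rfl
    | ok =>
      -- A normal finish would bound `F X = ⊤` by a finite weight.
      obtain ⟨X, hX, hno⟩ := rankReducible_iff.1 hred
      have := hle rfl X hX
      rw [F_eq_top hno] at this
      exact absurd this (by simp)
  · have hok : st = .ok := by
      cases st with
      | ok => rfl
      | error => exact absurd (hspec.error rfl) hred
    refine ⟨hok, hspec.good.feasible, ⟨⟨s.best.1, hspec.good.feasible.1,
      F_eq_of_isFeasible hspec.good.feasible⟩, ?_⟩, fun X hX hu => ?_⟩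
    · rintro _ ⟨X, hX, rfl⟩
      exact hle hok X hX
    · exact hspec.covered hok X hX hu (below_init hX hu)

end Run

/-! ### The greedy heuristic -/

/-- The scan starts at `⊥` and accepts only strict improvements, so a chosen element has a nonempty
replacement chain and its interdiction cannot fail. -/
theorem select_spec {X Y : Finset ℕ} {e : ℕ} (h : P.select X Y = some e) :
    e ∈ Y ∧ ⊥ < P.efficiency X Y e := by
  have key : ∀ (l : List ℕ) (a : WithBot ℚ × Option ℕ), (∀ x ∈ l, x ∈ Y) →
      (∀ x, a.2 = some x → x ∈ Y ∧ ⊥ < P.efficiency X Y x) →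
      ∀ x, (l.foldl (fun (bf : WithBot ℚ × Option ℕ) e =>
        if bf.1 < P.efficiency X Y e then (P.efficiency X Y e, some e) else bf) a).2 = some x →
        x ∈ Y ∧ ⊥ < P.efficiency X Y x := by
    intro l
    induction l with
    | nil => exact fun a _ ha => ha
    | cons y l ih =>
      intro a hl ha
      refine ih _ (fun x hx => hl x (List.mem_cons_of_mem _ hx)) ?_
      dsimp only
      split_ifs with hlt
      · intro x hx
        obtain rfl := Option.some.inj hx
        exact ⟨hl _ List.mem_cons_self, bot_le.trans_lt hlt⟩
      · exact ha
  refine key _ _ (fun x hx => ?_) (fun x hx => by cases hx) e h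
  exact (Finset.mem_filter.1 ((Finset.mem_sort _).1 hx)).1

theorem exists_repl_of_efficiency {X Y : Finset ℕ} {e : ℕ} (h : ⊥ < P.efficiency X Y e) :
    ∃ f, P.repl X Y e = some f ∧ P.cost (insert f (insert e X)) ≤ P.C := by
  have hne : P.chainTail X Y e ≠ [] := by
    intro hnil
    simp [efficiency, hnil] at h
  rw [chainTail] at hne
  split at hne
  · exact absurd rfl hne
  · next f hf =>
    split_ifs at hne with hc
    · exact ⟨f, hf, hc⟩
    · exact absurd rfl hne

/-- Each round moves one basis element into `X`, so `(P.E \ X).card` drops; greediness of the basis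
makes the final pair feasible. -/
theorem greedyLoop_spec (hA : P.Ordered) (k : ℕ) : ∀ X Y, P.Upper X → P.IsGreedyBase X Y →
    (P.E \ X).card < k → ∃ r, P.IsFeasible r ∧ ∀ n ≥ k, P.greedyLoop n X Y = some r := by
  induction k with
  | zero => exact fun X Y _ _ h => absurd h (Nat.not_lt_zero _)
  | succ k ih =>
    intro X Y hX hY hcard
    have hstep : ∀ n ≥ k + 1, ∃ n' ≥ k, n = n' + 1 := fun n hn => ⟨n - 1, by omega, by omega⟩
    rcases hsel : P.select X Y with _ | e
    · refine ⟨(X, Y), hY.isFeasible hA hX, fun n hn => ?_⟩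
      obtain ⟨n, -, rfl⟩ := hstep n hn
      simp only [greedyLoop, hsel]
    · obtain ⟨he, heff⟩ := select_spec hsel
      obtain ⟨f, hf, hc⟩ := exists_repl_of_efficiency heff
      have heX : e ∉ X := hY.1.notMem he
      have hup : P.Upper (insert e X) :=
        ⟨Finset.insert_subset (hY.1.mem_E he) hX.1,
          (Finset.sum_le_sum_of_subset (Finset.subset_insert f _)).trans hc⟩
      have hlt : (P.E \ insert e X).card < (P.E \ X).card := by
        refine Finset.card_lt_card ⟨Finset.sdiff_subset_sdiff subset_rfl
          (Finset.subset_insert e X), fun hsub => ?_⟩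
        exact (Finset.mem_sdiff.1 (hsub (Finset.mem_sdiff.2 ⟨hY.1.mem_E he, heX⟩))).2
          (Finset.mem_insert_self _ _)
      obtain ⟨r, hr, hrun⟩ := ih _ _ hup (hY.interdict he hf) (by omega)
      refine ⟨r, hr, fun n hn => ?_⟩
      obtain ⟨n, hn', rfl⟩ := hstep n hn
      simp only [greedyLoop, hsel, hf, hrun n hn']

theorem lowerBound_spec (hA : P.Ordered) :
    ∃ r N, P.IsFeasible r ∧ ∀ n ≥ N, P.lowerBound n = some r := by
  obtain ⟨B, hB, hG⟩ := P.exists_Bmin_empty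
  obtain ⟨r, hr, hrun⟩ := greedyLoop_spec hA _ ∅ B P.upper_empty hG (Nat.lt_succ_self _)
  refine ⟨r, (P.E \ ∅).card + 1, hr, fun n hn => ?_⟩
  rw [lowerBound, hB, Option.bind_some, hrun n hn]

end Interdiction

theorem mainTheorem3 (P : Interdiction) (hA1 : P.Ordered) {T : Type*}
    (φ : Finset ℕ → T) (π : ℕ → T → T) (δ : ℕ → ℕ → ℕ → T × Finset ℕ → WithTop ℤ)
    (hsucc : P.PSucc φ π)
    (hbound : ∀ p ≤ P.m, P.PBound (Interdiction.phiP φ p) (δ p))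
    (avail : ℕ → Option ℕ) (havail : ∀ k p, avail k = some p → p ≤ P.m) :
    P.RunCorrect (P.solve φ π δ avail) ∧
      ∀ start : Finset ℕ × Finset ℕ, P.IsFeasible start →
        P.RunCorrect (P.solveFrom φ π δ avail start) := by
  refine ⟨?_, fun start hstart =>
    Interdiction.runCorrect_solveFrom hA1 hsucc hbound havail hstart⟩
  obtain ⟨r, N, hr, hrun⟩ := Interdiction.lowerBound_spec hA1
  obtain ⟨st, s, ⟨N', hN'⟩, hcorrect⟩ :=
    Interdiction.runCorrect_solveFrom hA1 hsucc hbound havail hr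
  refine ⟨st, s, ⟨max N N', fun n hn => ?_⟩, hcorrect⟩
  rw [Interdiction.solve, hrun n (le_of_max_le_left hn), Option.bind_some]
  exact hN' n (le_of_max_le_right hn)
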